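/- **Setting.** Let $N,r,q,Q,t,t',B,B_{\rm KS}\ge 1$ and $n\ge 0$ be integers with $t$ even, $B,B_{\rm KS}>1$, $q<Q$, and put $R=\mathbb Z_Q[x]/(x^N+1)$, $l_B=\lceil\log_B Q\rceil$, $l_{\rm KS}=\lceil\log_{B_{\rm KS}}Q\rceil$. Elements of $\mathbb Z_p$ are read as integers in $[0,p)$ when they are scaled, rounded or decomposed into digits. An LWE$_{n,p}$ ciphertext under $\boldsymbol s$ is a pair $(\boldsymbol a,b)\in\mathbb Z_p^n\times\mathbb Z_p$ with phase $b-\boldsymbol a\cdot\boldsymbol s$; its error as a ciphertext of $m\in\mathbb Z_t$ is the representative $e\in(-p/2,p/2]$ of $\text{phase}-m\lfloor p/t\rfloor$; it is correctly decryptable to $m$ if its phase is $m\lfloor p/t\rfloor+e$ with $2|e|<\lfloor p/t\rfloor$. Modulus switch from $p$ to $p'$ replaces every entry $c$ by $\lfloor cp'/p\rceil \bmod p'$ (ties upwards). Let $\boldsymbol s\in\{-1,0,1\}^n$, $z\in R$ with coefficient vector $(z_0,\dots,z_{N-1})$, $s_{k+}=\max(s_k,0)$, $s_{k-}=\max(-s_k,0)$.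 RLWE ciphertexts are pairs $(a,b)\in R^2$ with phase $b-az$; an RGSW ciphertext of $\mu\in R$ consists of $2l_B$ RLWE pairs with phases $\mu B^j+e_{0,j}$ and $-z\mu B^j+e_{1,j}$, $0\le j<l_B$. The product of an RLWE ciphertext $(a,b)$ with it is the combination of its rows with coefficients the coefficientwise $B$-digits of $b$ (first block) and of $a$ (second block). **Keys.** The bootstrapping keys are RGSW ciphertexts of $s_{k+},s_{k-}$ ($1\le k\le n$). The key-switching keys ${\tt ct}(i,j,k)$, $0\le i<N$, $0\le j<l_{\rm KS}$, $0\le k<B_{\rm KS}$, are LWE$_{n,Q}$ ciphertexts with phase $z_iB_{\rm KS}^jk+e_{i,j,k}$ under $\boldsymbol s$. All masks (first components) of the keys are jointly uniform, and independent of the errors. All error coefficients are mutually independent integer random variables, zero-centered subgaussian, i.e. $\mathbb E\,e^{\lambda X}\le e^{\lambda^2v/2}$ for all real $\lambda$, with variance proxy $v=\sigma^2$ for the bootstrapping keys and $v=\sigma_{\rm KS}^2$ for the key-switching keys. **Algorithm BootMMPM.** Let $f:\mathbb Z_t\to\mathbb Z_{t'}$ be nega-cyclic ($f(k+t/2)=-f(k)$),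 and $f':\mathbb Z_{2Nr}\to\mathbb Z_{t'}$ a nega-cyclic extension ($f'(u+Nr)=-f'(u)$, and $f'(m\lfloor 2Nr/t\rfloor+e)=f(m)$ whenever $2|e|<\lfloor 2Nr/t\rfloor$). Let $\Phi(1)=\begin{bmatrix}&x\\ I_{r-1}&\end{bmatrix}\in R^{r\times r}$, $\Phi(c)=\Phi(1)^c$ for $c\in\mathbb Z_{2Nr}$, and let $\boldsymbol v\in R^r$ have entries $v_b=\sum_{a=0}^{N-1}f'(-(ar+b))\lfloor Q/t'\rfloor x^a$, $0\le b<r$. On input an LWE$_{n,q}$ ciphertext: 1. Switch the modulus from $q$ to $2Nr$, giving $(a_1,\dots,a_n,b)$. 2. $ACC\leftarrow\Phi(b)(0,\boldsymbol v)\in(R^2)^r$; for $k=1,\dots,n$, $ACC\leftarrow ACC+(\Phi(-a_k)ACC-ACC)\,{\tt ct}_{k+}+(\Phi(a_k)ACC-ACC)\,{\tt ct}_{k-}$, entrywise, where ${\tt ct}_{k\pm}$ are the keys encrypting $s_{k\pm}$. 3. From the first entry $(a,b)$ of $ACC$, where $a=\sum a_ix^i$ and $b=\sum b_ix^i$, extract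 $(a_0,-a_{N-1},\dots,-a_1,b_0)$. 4. Key switch: $(a_0',\dots,a_{N-1}',b')\mapsto(0^n,b')-\sum_{i,j}{\tt ct}(i,j,a'_{i,j})$, with $a'_{i,j}$ the $j$-th $B_{\rm KS}$-digit of $a'_i$. 5. Switch the modulus from $Q$ to $q$. **Theorem.** For every real $K$ there is a constant $C>0$, depending only on $K$, such that the following holds for all parameters as above with $nq\le KQ$, $(Q\bmod t')\,q\le KQ$ and $q\bmod t'\le K$, all $f,f',\boldsymbol s,z$, all key distributions as above, and every LWE$_{n,q}$ ciphertext and every $m\in\mathbb Z_t$. If after modulus switch from $q$ to $2Nr$ the ciphertext is correctly decryptable to $m$, then Algorithm BootMMPM outputs an LWE$_{n,q}$ ciphertext whose error $e$, as a ciphertext of $f(m)$ under $\boldsymbol s$, is subgaussian with variance proxy $$V=4nNl_BB^2(q/Q)^2\sigma^2+Nl_{\rm KS}(q/Q)^2\sigma_{\rm KS}^2+\frac{\|\boldsymbol s\|_2^2+1}{12}$$ and constant $C$, that is, $\mathbb E\,e^{\lambda e}\le C\,e^{\lambda^2V/2}$ for all $\lambda\in\mathbb R$ and $\Pr(|e|>u)\le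 C\,e^{-u^2/(2V)}$ for all $u>0$. -/

import Mathlib

open MeasureTheory ProbabilityTheory
open scoped NNReal

namespace BootMMPM

noncomputable section

/-! ### The rings `R_{N,p} = Z_p[x]/(x^N+1)` -/

/-- The ring `R_{N,p} = Z_p[x]/(x^N+1)`. -/
abbrev Rq (N p : ℕ) : Type :=
  AdjoinRoot (Polynomial.X ^ N + 1 : Polynomial (ZMod p))

theorem monic_modulus (N p : ℕ) [NeZero N] :
    (Polynomial.X ^ N + 1 : Polynomial (ZMod p)).Monic := by
  have h := Polynomial.monic_X_pow_add_C (1 : ZMod p) (NeZero.ne N)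
  simpa using h

/-- The class of `x`. -/
def xR (N p : ℕ) : Rq N p := AdjoinRoot.root _

/-- The element `c_0 + c_1 x + ⋯ + c_{N-1} x^{N-1}`. -/
def ofCoeffs {N p : ℕ} (c : Fin N → ZMod p) : Rq N p :=
  ∑ i : Fin N, AdjoinRoot.of _ (c i) * xR N p ^ (i : ℕ)

/-- The `i`-th entry of the coefficient vector, that is, the coefficient of `x^i` in the unique
representative of degree less than `N`. -/
def coeff {N p : ℕ} [NeZero N] (a : Rq N p) (i : ℕ) : ZMod p :=
  (AdjoinRoot.modByMonicHom (monic_modulus N p) a).coeff i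

/-! ### Digit decomposition -/

/-- The length `⌈log_B Q⌉` of the `B`-digit decomposition modulo `Q`. -/
abbrev digits (B Q : ℕ) : ℕ := Nat.clog B Q

/-- The `j`-th digit of `a`, taken coefficientwise, where a coefficient is read as an integer
in `[0, Q)`. -/
def digit {N Q : ℕ} [NeZero N] (B : ℕ) (j : ℕ) (a : Rq N Q) : Rq N Q :=
  ofCoeffs fun i => (((coeff a i).val / B ^ j % B : ℕ) : ZMod Q)

/-! ### LWE ciphertexts -/

/-- Pairs `(a, b)` with `a ∈ Z_q^n`, `b ∈ Z_q`. -/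
abbrev LWE (n q : ℕ) : Type := (Fin n → ZMod q) × ZMod q

/-- `phase(a, b) = b - a · s`. -/
def LWE.phase {n q : ℕ} (s : Fin n → ZMod q) (ct : LWE n q) : ZMod q :=
  ct.2 - ∑ i, ct.1 i * s i

/-- `m ⌊q/t⌋ mod q`, where `m` is read as an integer in `[0, t)`. -/
def scaled {t : ℕ} (q : ℕ) (m : ZMod t) : ZMod q := ((m.val * (q / t) : ℕ) : ZMod q)

/-- The error of `ct` as a ciphertext of `m`: the representative of `phase - m ⌊q/t⌋ mod q`
in `(-q/2, q/2]`. -/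
def LWE.error {n q t : ℕ} (s : Fin n → ZMod q) (m : ZMod t) (ct : LWE n q) : ℤ :=
  (ct.phase s - scaled q m).valMinAbs

/-- `ct` decrypts correctly to `m`: its phase is `m ⌊q/t⌋ + e` with `2|e| < ⌊q/t⌋`. -/
def LWE.DecryptsTo {n q t : ℕ} (s : Fin n → ZMod q) (m : ZMod t) (ct : LWE n q) : Prop :=
  ∃ e : ℤ, 2 * |e| < ((q / t : ℕ) : ℤ) ∧ ct.phase s = scaled q m + (e : ZMod q)

/-- `⌊c p'/p⌉ mod p'`. -/
def switchCoord {p : ℕ} (p' : ℕ) (c : ZMod p) : ZMod p' :=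
  ((round ((c.val : ℚ) * p' / p) : ℤ) : ZMod p')

/-- Modulus switch from `p` to `p'`, by rounding every entry to a nearest integer. -/
def modSwitch {n p : ℕ} (p' : ℕ) (ct : LWE n p) : LWE n p' :=
  (fun i => switchCoord p' (ct.1 i), switchCoord p' ct.2)

/-! ### RLWE and RGSW ciphertexts -/

/-- Pairs `(a, b)` with `a, b ∈ R_{N,Q}`. -/
abbrev RLWE (N Q : ℕ) : Type := Rq N Q × Rq N Q

/-- `phase(a, b) = b - a z`. -/
def RLWE.phase {N Q : ℕ} (z : Rq N Q) (ct : RLWE N Q) : Rq N Q := ct.2 - ct.1 * z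

/-- `2 l × 2` matrices over `R_{N,Q}`, as two blocks of `l` rows. Each row is an RLWE pair. -/
abbrev RGSW (N Q l : ℕ) : Type := Fin 2 → Fin l → RLWE N Q

/-- The noiseless phases `m B^j` and `-z m B^j` of the rows of an RGSW ciphertext of `m`. -/
def gadgetPhase {N Q : ℕ} (B : ℕ) (z m : Rq N Q) (β : Fin 2) (j : ℕ) : Rq N Q :=
  if β = 0 then m * (B : Rq N Q) ^ j else -(z * m * (B : Rq N Q) ^ j)

/-- The RGSW ciphertext of `m` with secret `z`, masks `a` and errors `e`. -/
def RGSW.encrypt {N Q l : ℕ} (B : ℕ) (z m : Rq N Q) (a e : Fin 2 → Fin l → Rq N Q) :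
    RGSW N Q l :=
  fun β j => (a β j, a β j * z + gadgetPhase B z m β j + e β j)

theorem RGSW.phase_encrypt {N Q l : ℕ} (B : ℕ) (z m : Rq N Q) (a e : Fin 2 → Fin l → Rq N Q)
    (β : Fin 2) (j : Fin l) :
    RLWE.phase z (RGSW.encrypt B z m a e β j) = gadgetPhase B z m β j + e β j := by
  simp only [RLWE.phase, RGSW.encrypt]; ring

/-- The product of an RLWE ciphertext with an RGSW ciphertext. The digits of the second
component multiply the block with phases `m B^j`, those of the first component the block
with phases `-z m B^j`. -/
def extProd {N Q l : ℕ} [NeZero N] (B : ℕ) (ct : RLWE N Q) (C : RGSW N Q l) : RLWE N Q :=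
  ∑ j : Fin l, (digit B j ct.2 • C 0 j + digit B j ct.1 • C 1 j)

/-- The LWE ciphertext of the constant term of an RLWE plaintext:
`(a_0, -a_{N-1}, …, -a_1, b_0)`. -/
def sampleExtract {N Q : ℕ} [NeZero N] (ct : RLWE N Q) : LWE N Q :=
  (fun i => if (i : ℕ) = 0 then coeff ct.1 0 else -coeff ct.1 (N - i), coeff ct.2 0)

/-! ### Key switching -/

/-- The key-switching keys: LWE ciphertexts `ct(i, j, k)`. -/
abbrev KSKeys (N n Q l b : ℕ) : Type := Fin N → Fin l → Fin b → LWE n Q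

/-- The LWE ciphertexts of `z_i b^j k` with secret `s`, masks `a` and errors `e`. -/
def ksKeyGen {N n Q l b : ℕ} (z : Fin N → ZMod Q) (s : Fin n → ZMod Q)
    (a : Fin N → Fin l → Fin b → Fin n → ZMod Q) (e : Fin N → Fin l → Fin b → ZMod Q) :
    KSKeys N n Q l b :=
  fun i j k => (a i j k,
    (∑ h, a i j k h * s h) + z i * (b : ZMod Q) ^ (j : ℕ) * ((k : ℕ) : ZMod Q) + e i j k)

/-- `(0, b) - ∑_{i,j} ct(i, j, a_{i,j})`, where `a_{i,j}` is the `j`-th digit of `a_i`. -/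
def keySwitch {N n Q l b : ℕ} [NeZero b] (ksk : KSKeys N n Q l b) (ct : LWE N Q) : LWE n Q :=
  ((0 : Fin n → ZMod Q), ct.2) -
    ∑ i : Fin N, ∑ j : Fin l, ksk i j (Fin.ofNat b ((ct.1 i).val / b ^ (j : ℕ)))

/-! ### Monic monomial permutation matrices -/

/-- The matrix `[[0, x], [I_{r-1}, 0]]`. -/
def PhiOne (N Q r : ℕ) : Matrix (Fin r) (Fin r) (Rq N Q) :=
  Matrix.of fun i j =>
    if (i : ℕ) = j + 1 then 1 else if (i : ℕ) = 0 ∧ (j : ℕ) + 1 = r then xR N Q else 0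

/-- The representation `Φ` of `Z_{2Nr}` with `Φ(1) = PhiOne`. -/
def Phi (N Q r : ℕ) (c : ZMod (2 * N * r)) : Matrix (Fin r) (Fin r) (Rq N Q) :=
  PhiOne N Q r ^ c.val

/-- The product of a plaintext matrix with an RLWE vector. -/
def act {N Q r : ℕ} (M : Matrix (Fin r) (Fin r) (Rq N Q)) (v : Fin r → RLWE N Q) :
    Fin r → RLWE N Q :=
  fun i => ∑ j, M i j • v j

/-! ### Nega-cyclic functions and test vectors -/

/-- `f (k + t/2) = -f k` (used for even `t`). -/
def IsNegacyclic {t t' : ℕ} (f : ZMod t → ZMod t') : Prop :=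
  ∀ k, f (k + ((t / 2 : ℕ) : ZMod t)) = -f k

/-- `f'` is a nega-cyclic extension of `f` from `Z_t` to `Z_M`. -/
def IsNegacyclicExtension {t t' M : ℕ} (f : ZMod t → ZMod t') (f' : ZMod M → ZMod t') : Prop :=
  IsNegacyclic f' ∧
    ∀ (m : ZMod t) (e : ℤ), 2 * |e| < ((M / t : ℕ) : ℤ) → f' (scaled M m + (e : ZMod M)) = f m

/-- The test polynomial vector, scaled by `⌊Q/t'⌋`: its `b`-th entry is
`∑_{a < N} f'(-(a r + b)) ⌊Q/t'⌋ x^a`. -/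
def testVector {N r t' : ℕ} (Q : ℕ) (f' : ZMod (2 * N * r) → ZMod t') : Fin r → Rq N Q :=
  fun b => ofCoeffs fun a : Fin N =>
    scaled Q (f' (-(((a : ℕ) * r + (b : ℕ) : ℕ) : ZMod (2 * N * r))))

/-! ### The algorithm -/

/-- One round of phase accumulation: the homomorphic evaluation of
`CMux(s_{k+}, s_{k-}; Φ(-a_k), I, Φ(a_k))` on `acc`. -/
def cmuxStep {N Q r l : ℕ} [NeZero N] (B : ℕ) (Cp Cm : RGSW N Q l) (a : ZMod (2 * N * r))
    (acc : Fin r → RLWE N Q) : Fin r → RLWE N Q :=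
  fun i => acc i + extProd B (act (Phi N Q r (-a)) acc i - acc i) Cp
    + extProd B (act (Phi N Q r a) acc i - acc i) Cm

/-- The phase accumulation loop on a ciphertext modulo `2Nr`. The bootstrapping keys are indexed
by `k` and a sign: `bk k 0` encrypts `s_{k+}` and `bk k 1` encrypts `s_{k-}`. -/
def accumulate {n N Q r l t' : ℕ} [NeZero N] (B : ℕ) (bk : Fin n → Fin 2 → RGSW N Q l)
    (f' : ZMod (2 * N * r) → ZMod t') (ct : LWE n (2 * N * r)) : Fin r → RLWE N Q :=
  Fin.foldl n (fun acc k => cmuxStep B (bk k 0) (bk k 1) (ct.1 k) acc)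
    (act (Phi N Q r ct.2) fun i => (0, testVector Q f' i))

/-- Algorithm BootMMPM: modulus switch to `2Nr`, phase accumulation, constant-term extraction
from the first entry, key switch, modulus switch from `Q` to `q`. -/
def boot {n N Q r q t' l lKS BKS : ℕ} [NeZero N] [NeZero r] [NeZero BKS] (B : ℕ)
    (bk : Fin n → Fin 2 → RGSW N Q l) (ksk : KSKeys N n Q lKS BKS)
    (f' : ZMod (2 * N * r) → ZMod t') (ct : LWE n q) : LWE n q :=
  modSwitch q (keySwitch ksk (sampleExtract
    (accumulate B bk f' (modSwitch (2 * N * r) ct) 0)))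

/-! ### Random generation of the keys -/

/-- Indices of the coefficients of the bootstrapping keys: position `k`, sign, block, digit,
coefficient. -/
abbrev BKIdx (n N l : ℕ) : Type := Fin n × Fin 2 × Fin 2 × Fin l × Fin N

/-- Indices of the key-switching keys. -/
abbrev KSIdx (N lKS BKS : ℕ) : Type := Fin N × Fin lKS × Fin BKS

/-- Indices of all mask coordinates. -/
abbrev MaskIdx (n N l lKS BKS : ℕ) : Type := BKIdx n N l ⊕ (KSIdx N lKS BKS × Fin n)

/-- Indices of all error coefficients. -/
abbrev ErrIdx (n N l lKS BKS : ℕ) : Type := BKIdx n N l ⊕ KSIdx N lKS BKS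

/-- The RGSW ciphertexts of `s_{k+} = max(s_k, 0)` (sign `0`) and `s_{k-} = max(-s_k, 0)`
(sign `1`) with secret `z`. -/
def bootKeys {n N Q l lKS BKS : ℕ} (B : ℕ) (s : Fin n → ℤ) (z : Rq N Q)
    (mask : MaskIdx n N l lKS BKS → ZMod Q) (err : ErrIdx n N l lKS BKS → ℤ) :
    Fin n → Fin 2 → RGSW N Q l :=
  fun k σ => RGSW.encrypt B z (((if σ = 0 then max (s k) 0 else max (-s k) 0 : ℤ)) : Rq N Q)
    (fun β j => ofCoeffs fun i => mask (Sum.inl (k, σ, β, j, i)))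
    (fun β j => ofCoeffs fun i => (err (Sum.inl (k, σ, β, j, i)) : ZMod Q))

/-- The key-switching keys from the coefficient vector of `z` to `s`. -/
def switchKeys {n N Q l lKS BKS : ℕ} [NeZero N] (s : Fin n → ℤ) (z : Rq N Q)
    (mask : MaskIdx n N l lKS BKS → ZMod Q) (err : ErrIdx n N l lKS BKS → ℤ) :
    KSKeys N n Q lKS BKS :=
  ksKeyGen (fun i => coeff z i) (fun h => (s h : ZMod Q))
    (fun i j k h => mask (Sum.inr ((i, j, k), h)))
    (fun i j k => (err (Sum.inr (i, j, k)) : ZMod Q))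

/-- The randomness of the keys: uniform masks, independent of the errors; the errors are
mutually independent zero-centered subgaussian integers, with variance proxy `σ²` in the
bootstrapping keys and `σKS²` in the key-switching keys. -/
structure IsKeyRandomness {Ω : Type*} [MeasurableSpace Ω] (μ : Measure Ω)
    {n N Q l lKS BKS : ℕ} (σ σKS : ℝ≥0) (mask : Ω → MaskIdx n N l lKS BKS → ZMod Q)
    (err : Ω → ErrIdx n N l lKS BKS → ℤ) : Prop where
  measurable_mask : Measurable mask
  measurable_err : Measurable err
  uniform_mask : μ.map mask = uniformOn Set.univ
  indep_mask_err : IndepFun mask err μ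
  indep_err : iIndepFun (fun (i : ErrIdx n N l lKS BKS) (ω : Ω) => err ω i) μ
  subgaussian_boot : ∀ i, HasSubgaussianMGF (fun ω => (err ω (Sum.inl i) : ℝ)) (σ ^ 2) μ
  subgaussian_switch : ∀ i, HasSubgaussianMGF (fun ω => (err ω (Sum.inr i) : ℝ)) (σKS ^ 2) μ

/-- `X` is subgaussian with variance proxy `V` and constant `C`: both its moment generating
function and its tail are bounded, up to the factor `C`, as for a centered Gaussian variable
of variance `V`. -/
structure IsSubgaussian {Ω : Type*} [MeasurableSpace Ω] (μ : Measure Ω)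
    (C V : ℝ) (X : Ω → ℝ) : Prop where
  integrable_exp : ∀ a : ℝ, Integrable (fun ω => Real.exp (a * X ω)) μ
  mgf_le : ∀ a : ℝ, mgf X μ a ≤ C * Real.exp (V * a ^ 2 / 2)
  tail_le : ∀ u : ℝ, 0 < u → μ.real {ω | u < |X ω|} ≤ C * Real.exp (-u ^ 2 / (2 * V))

end

end BootMMPM

-- The proof tracks phases. The digits recombine to the ciphertext in an external product, so for
-- ternary `s_k` one round acts on the phases as `Φ(-a_k s_k)` plus noise. Composing the rounds
-- gives total rotation `b - a·s`, the phase modulo `2Nr`. The constant coefficient of the first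
-- entry then reads `f'` at that phase, which is `f m` (`coeff_phiOne_pow_testVector`,
-- `phase_accAfter`).
--
-- The noise of round `k` passes through the later rotations, whose exponents do not depend on the
-- keys. Hence it contributes, up to sign, a single coefficient of a sum of `4l` products of digit
-- polynomials with errors: a linear form in the `4Nl` errors of that round, with coefficients at
-- most `B` in absolute value. These depend only on masks and on errors of earlier rounds
-- (`exists_bootCoeff`). The key-switching errors behave like one more round, where bootstrapping
-- data select one error for each `(i, j)`. With the bootstrapping masks fixed, independence is
-- applied round by round, so the variance proxies add as if the coefficients were constants
-- (`lintegral_exp_adapted_le`).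
--
-- The last modulus switch adds `∑ s_h δ_h`, where `δ_h` is the rounding error of an output mask
-- coordinate. The key-switching masks do not enter the linear error, and conditionally on
-- everything else the output mask is uniform. So this sum can be averaged separately
-- (`sum_mask_exp_le`). Each `δ_h` is uniform on a grid of step `1/m`, with variance proxy `1/12`
-- and a bias at most `q/(2Q)`; the biases add up to at most `K/2`.
--
-- What remains is deterministic: at most `1/2` from rounding the body and `2K` from the floors. All
-- bounded contributions `L` are absorbed by `|a|L ≤ 6L² + a²/24`. This uses up the extra `1/12` in
-- the variance proxy and makes the constant depend on `K` alone. The tail bound is Chernoff's.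

namespace BootMMPM

set_option linter.unusedSectionVars false

-- Coefficients and digits in the negacyclic ring

section Ring

variable {N Q : ℕ} [NeZero N]

theorem coeff_add (a b : Rq N Q) (i : ℕ) : coeff (a + b) i = coeff a i + coeff b i := by
  simp [coeff]

theorem coeff_sub (a b : Rq N Q) (i : ℕ) : coeff (a - b) i = coeff a i - coeff b i := by
  simp [coeff]

theorem coeff_sum {ι : Type*} (S : Finset ι) (a : ι → Rq N Q) (i : ℕ) :
    coeff (∑ k ∈ S, a k) i = ∑ k ∈ S, coeff (a k) i := by
  simp [coeff, map_sum, Polynomial.finsetSum_coeff]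

theorem coeff_of_mul (c : ZMod Q) (a : Rq N Q) (i : ℕ) :
    coeff (AdjoinRoot.of _ c * a) i = c * coeff a i := by
  have h : AdjoinRoot.of (Polynomial.X ^ N + 1 : Polynomial (ZMod Q)) c * a = c • a := by
    rw [Algebra.smul_def]; rfl
  rw [h]; simp [coeff]

theorem ofCoeffs_eq_mk (c : Fin N → ZMod Q) :
    ofCoeffs c = AdjoinRoot.mk (Polynomial.X ^ N + 1 : Polynomial (ZMod Q))
      (∑ i : Fin N, Polynomial.C (c i) * Polynomial.X ^ (i : ℕ)) := by
  simp [ofCoeffs, xR, map_sum]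

theorem coeff_ofCoeffs (c : Fin N → ZMod Q) (i : Fin N) : coeff (ofCoeffs c) i = c i := by
  -- Over the zero ring (`Q = 1`) the modulus does not have degree `N`, so this case is split off.
  rcases subsingleton_or_nontrivial (ZMod Q) with _ | _
  · exact Subsingleton.elim _ _
  · rw [ofCoeffs_eq_mk, coeff, AdjoinRoot.modByMonicHom_mk,
      (Polynomial.modByMonic_eq_self_iff (monic_modulus N Q)).2]
    · simp [Polynomial.finsetSum_coeff, Polynomial.coeff_X_pow, Fin.val_inj]
    · have hd : (Polynomial.X ^ N + 1 : Polynomial (ZMod Q)).degree = N := by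
        simpa using Polynomial.degree_X_pow_add_C (NeZero.pos N) (1 : ZMod Q)
      rw [hd]
      exact Polynomial.degree_sum_fin_lt c

theorem ofCoeffs_coeff (a : Rq N Q) : ofCoeffs (fun i : Fin N => coeff a i) = a := by
  rcases subsingleton_or_nontrivial (ZMod Q) with _ | _
  · have : Subsingleton (Rq N Q) := by
      refine ⟨fun a b => ?_⟩
      obtain ⟨p, rfl⟩ := AdjoinRoot.mk_surjective a
      obtain ⟨q, rfl⟩ := AdjoinRoot.mk_surjective b
      rw [Subsingleton.elim p q]
    exact Subsingleton.elim _ _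
  · rw [ofCoeffs_eq_mk]
    conv_rhs => rw [← AdjoinRoot.mk_leftInverse (monic_modulus N Q) a]
    congr 1
    have hd : (AdjoinRoot.modByMonicHom (monic_modulus N Q) a).natDegree < N := by
      obtain ⟨p, rfl⟩ := AdjoinRoot.mk_surjective a
      rw [AdjoinRoot.modByMonicHom_mk]
      have h := Polynomial.natDegree_modByMonic_lt p (monic_modulus N Q) (by
        intro h1
        have := congrArg Polynomial.natDegree h1
        have hN := NeZero.ne N
        have hd : (Polynomial.X ^ N + 1 : Polynomial (ZMod Q)).natDegree = N := by
          simpa using Polynomial.natDegree_X_pow_add_C (n := N) (r := (1 : ZMod Q))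
        rw [hd] at this; simp at this; exact hN this)
      have hd : (Polynomial.X ^ N + 1 : Polynomial (ZMod Q)).natDegree = N := by
        simpa using Polynomial.natDegree_X_pow_add_C (n := N) (r := (1 : ZMod Q))
      rwa [hd] at h
    conv_rhs => rw [Polynomial.as_sum_range_C_mul_X_pow' _ hd]
    rw [Finset.sum_range]
    rfl

theorem xR_pow_N : xR N Q ^ N = -1 := by
  have h : AdjoinRoot.mk (Polynomial.X ^ N + 1 : Polynomial (ZMod Q)) (Polynomial.X ^ N + 1) = 0 :=
    AdjoinRoot.mk_self
  have h' : xR N Q ^ N + 1 = 0 := by rw [← h, xR, AdjoinRoot.root]; simp only [map_add, map_pow, map_one]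
  exact eq_neg_of_add_eq_zero_left h'

theorem coeff_xR_mul (a : Rq N Q) (i : ℕ) (hi : i < N) :
    coeff (xR N Q * a) i = if i = 0 then -coeff a (N - 1) else coeff a (i - 1) := by
  obtain ⟨M, rfl⟩ : ∃ M, N = M + 1 := Nat.exists_eq_succ_of_ne_zero (NeZero.ne N)
  have key : xR (M + 1) Q * a = ofCoeffs (fun i : Fin (M + 1) =>
      if (i : ℕ) = 0 then -coeff a M else coeff a ((i : ℕ) - 1)) := by
    conv_lhs => rw [← ofCoeffs_coeff a]
    unfold ofCoeffs
    rw [Fin.sum_univ_castSucc, Fin.sum_univ_succ, mul_add, add_comm (xR (M + 1) Q * _), Finset.mul_sum]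
    have hx := xR_pow_N (N := M + 1) (Q := Q)
    congr 1
    · simp only [Fin.val_last, Fin.val_zero, if_true, pow_zero, mul_one, map_neg]
      rw [mul_left_comm, ← pow_succ', hx]; ring
    · refine Finset.sum_congr rfl fun i _ => ?_
      simp [pow_succ]; ring
  rw [key]
  exact coeff_ofCoeffs _ ⟨i, hi⟩

theorem coeff_xR_pow_mul (a : Rq N Q) (i : ℕ) (hi : i ≤ N) (u : ℕ) (hu : u < N) :
    coeff (xR N Q ^ i * a) u = if i ≤ u then coeff a (u - i) else -coeff a (u + N - i) := by
  induction i generalizing u with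
  | zero => simp
  | succ i ih =>
    rw [pow_succ', mul_assoc, coeff_xR_mul _ _ hu]
    rcases Nat.eq_zero_or_pos u with rfl | hu0
    · rw [if_pos rfl, ih (by omega) _ (by omega), if_pos (by omega), if_neg (by omega)]
      congr 2; omega
    · rw [if_neg (by omega), ih (by omega) _ (by omega)]
      by_cases h : i + 1 ≤ u
      · rw [if_pos (by omega), if_pos h]; congr 1; omega
      · rw [if_neg (by omega), if_neg h]; congr 2; omega

theorem coeff_mul_ofCoeffs (a : Rq N Q) (c : Fin N → ZMod Q) (u : ℕ) (hu : u < N) :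
    coeff (a * ofCoeffs c) u = ∑ i : Fin N, c i *
      (if (i : ℕ) ≤ u then coeff a (u - i) else -coeff a (u + N - i)) := by
  rw [ofCoeffs, Finset.mul_sum, coeff_sum]
  refine Finset.sum_congr rfl fun i _ => ?_
  rw [← coeff_xR_pow_mul a i i.2.le u hu, ← coeff_of_mul]
  congr 1; ring

theorem ofCoeffs_sum {ι : Type*} (S : Finset ι) (c : ι → Fin N → ZMod Q) :
    ∑ j ∈ S, ofCoeffs (c j) = ofCoeffs (fun i => ∑ j ∈ S, c j i) := by
  simp only [ofCoeffs, map_sum, Finset.sum_mul]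
  exact Finset.sum_comm

theorem ofCoeffs_mul_natCast (c : Fin N → ZMod Q) (k : ℕ) :
    ofCoeffs c * (k : Rq N Q) = ofCoeffs (fun i => c i * (k : ZMod Q)) := by
  simp only [ofCoeffs, map_mul, map_natCast, Finset.sum_mul]
  exact Finset.sum_congr rfl fun i _ => by ring

theorem sum_digits_mul_pow (x b l : ℕ) :
    ∑ j ∈ Finset.range l, x / b ^ j % b * b ^ j = x % b ^ l := by
  induction l with
  | zero => simp [Nat.mod_one]
  | succ l ih => rw [Finset.sum_range_succ, ih, Nat.mod_pow_succ, mul_comm]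

theorem sum_fin_digits (x : ZMod Q) [NeZero Q] (b l : ℕ) (h : Q ≤ b ^ l) :
    ∑ j : Fin l, ((x.val / b ^ (j : ℕ) % b : ℕ) : ZMod Q) * (b : ZMod Q) ^ (j : ℕ) = x := by
  have h1 := sum_digits_mul_pow x.val b l
  rw [Nat.mod_eq_of_lt (x.val_lt.trans_le h), Finset.sum_range] at h1
  have h2 := congrArg (Nat.cast : ℕ → ZMod Q) h1
  simpa using h2

theorem sum_digit_mul_pow [NeZero Q] (B l : ℕ) (h : Q ≤ B ^ l) (a : Rq N Q) :
    ∑ j : Fin l, digit B j a * (B : Rq N Q) ^ (j : ℕ) = a := by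
  conv_rhs => rw [← ofCoeffs_coeff a]
  simp only [digit, ← Nat.cast_pow, ofCoeffs_mul_natCast, ofCoeffs_sum]
  congr 1; funext i
  have := sum_fin_digits (coeff a i) B l h
  simpa using this

end Ring

-- Powers of the monomial matrix

section Phi

variable {N Q r : ℕ} [NeZero N] [NeZero r]

theorem phiOne_mulVec_succ (w : Fin r → Rq N Q) (b : ℕ) (hb : b + 1 < r) :
    (PhiOne N Q r).mulVec w ⟨b + 1, hb⟩ = w ⟨b, by omega⟩ := by
  rw [Matrix.mulVec, dotProduct, Finset.sum_eq_single ⟨b, by omega⟩]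
  · simp [PhiOne]
  · intro j _ hj
    have : (j : ℕ) ≠ b := fun h => hj (Fin.ext h)
    simp [PhiOne, Ne.symm this]
  · simp

theorem phiOne_mulVec_zero (w : Fin r → Rq N Q) (hr : 0 < r) :
    (PhiOne N Q r).mulVec w ⟨0, hr⟩ = xR N Q * w ⟨r - 1, by omega⟩ := by
  rw [Matrix.mulVec, dotProduct, Finset.sum_eq_single ⟨r - 1, by omega⟩]
  · simp [PhiOne]; intro h; omega
  · intro j _ hj
    have : (j : ℕ) + 1 ≠ r := fun h => hj (Fin.ext (by simp; omega))
    simp [PhiOne, this]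
  · simp

/-- With `y^r = x`, a vector `w` is the polynomial `∑ w_b y^b` modulo `y^(Nr) + 1`, and `Φ(1)` is
multiplication by `y`. Coefficient `a` of entry `b` sits at position `ar + b`, so `y^c` brings to
position `0` the coefficient at position `-c` modulo `Nr`. The sign `ε` records which lift modulo
`2Nr` occurs. The data do not depend on `w`, which later keeps them independent of the keys. -/
theorem exists_coeff_phiOne_pow_mulVec (c : ℕ) :
    ∃ a < N, ∃ (b : Fin r) (ε : ℤ),
      ((ε = 1 ∧ 2 * N * r ∣ c + (a * r + b)) ∨ (ε = -1 ∧ 2 * N * r ∣ c + (a * r + b) + N * r)) ∧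
      ∀ w : Fin r → Rq N Q,
        coeff ((PhiOne N Q r ^ c).mulVec w 0) 0 = (ε : ZMod Q) * coeff (w b) a := by
  induction c with
  | zero => exact ⟨0, NeZero.pos N, 0, 1, by simp, fun w => by simp⟩
  | succ c ih =>
    obtain ⟨a, ha, ⟨b, hb⟩, ε, hε, h⟩ := ih
    have hr := NeZero.pos r
    -- One more factor `y` moves the position down by one: within a row block, across a block
    -- boundary through `x`, or from `0` to `Nr - 1` with a change of sign.
    rcases b with _ | b
    · rcases a with _ | a
      · have e1 : c + 1 + ((N - 1) * r + (r - 1)) = c + N * r := by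
          obtain ⟨M, rfl⟩ := Nat.exists_eq_succ_of_ne_zero (NeZero.ne N)
          simp only [Nat.succ_eq_add_one, Nat.add_sub_cancel]
          have : (M + 1) * r = M * r + r := by ring
          omega
        refine ⟨N - 1, by omega, ⟨r - 1, by omega⟩, -ε, ?_, fun w => ?_⟩
        · rcases hε with ⟨rfl, hd⟩ | ⟨rfl, hd⟩
          · right
            refine ⟨rfl, ?_⟩
            simp only [e1]
            simp only [zero_mul, add_zero] at hd
            have : c + N * r + N * r = c + 2 * N * r := by ring
            rw [this]; exact Dvd.dvd.add hd (dvd_refl _)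
          · left
            refine ⟨rfl, ?_⟩
            simp only [e1]
            simpa using hd
        · rw [pow_succ, ← Matrix.mulVec_mulVec, h, phiOne_mulVec_zero, coeff_xR_mul _ _ ha]
          simp
      · have e1 : c + 1 + (a * r + (r - 1)) = c + ((a + 1) * r + 0) := by
          have : (a + 1) * r = a * r + r := by ring
          omega
        refine ⟨a, by omega, ⟨r - 1, by omega⟩, ε, ?_, fun w => ?_⟩
        · simp only [e1]; exact hε
        · rw [pow_succ, ← Matrix.mulVec_mulVec, h, phiOne_mulVec_zero, coeff_xR_mul _ _ ha]
          simp
    · have e1 : c + 1 + (a * r + b) = c + (a * r + (b + 1)) := by ring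
      refine ⟨a, ha, ⟨b, by omega⟩, ε, ?_, fun w => ?_⟩
      · simp only [e1]; exact hε
      · rw [pow_succ, ← Matrix.mulVec_mulVec, h, phiOne_mulVec_succ]

end Phi

-- Phases and external products

section Phase

variable {N Q r l : ℕ}

theorem RLWE.phase_add (z : Rq N Q) (x y : RLWE N Q) :
    RLWE.phase z (x + y) = RLWE.phase z x + RLWE.phase z y := by
  simp only [RLWE.phase, Prod.fst_add, Prod.snd_add]; ring

theorem RLWE.phase_sub (z : Rq N Q) (x y : RLWE N Q) :
    RLWE.phase z (x - y) = RLWE.phase z x - RLWE.phase z y := by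
  simp only [RLWE.phase, Prod.fst_sub, Prod.snd_sub]; ring

theorem RLWE.phase_smul (z c : Rq N Q) (x : RLWE N Q) :
    RLWE.phase z (c • x) = c * RLWE.phase z x := by
  simp only [RLWE.phase, Prod.smul_fst, Prod.smul_snd, smul_eq_mul]; ring

theorem RLWE.phase_sum {ι : Type*} (S : Finset ι) (z : Rq N Q) (x : ι → RLWE N Q) :
    RLWE.phase z (∑ i ∈ S, x i) = ∑ i ∈ S, RLWE.phase z (x i) := by
  simp only [RLWE.phase, Prod.fst_sum, Prod.snd_sum, Finset.sum_mul, Finset.sum_sub_distrib]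

theorem phase_act (z : Rq N Q) (M : Matrix (Fin r) (Fin r) (Rq N Q)) (v : Fin r → RLWE N Q)
    (i : Fin r) :
    RLWE.phase z (act M v i) = M.mulVec (fun j => RLWE.phase z (v j)) i := by
  simp only [act, RLWE.phase_sum, RLWE.phase_smul, Matrix.mulVec, dotProduct]

/-- The component of an RLWE pair whose digits multiply block `β` in an external product. -/
def RLWE.component (ct : RLWE N Q) (β : Fin 2) : Rq N Q := if β = 0 then ct.2 else ct.1

variable [NeZero N] [NeZero Q]

/-- Because `Q ≤ B ^ l`, the digits recombine exactly: the first block contributes `m b` and the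
second `-z m a`, together `m` times the phase. Only the digit-weighted errors remain. -/
theorem phase_extProd_encrypt (B : ℕ) (h : Q ≤ B ^ l) (z m : Rq N Q)
    (a e : Fin 2 → Fin l → Rq N Q) (ct : RLWE N Q) :
    RLWE.phase z (extProd B ct (RGSW.encrypt B z m a e)) =
      m * RLWE.phase z ct + ∑ β : Fin 2, ∑ j : Fin l, digit B j (ct.component β) * e β j := by
  have h1 := sum_digit_mul_pow B l h ct.1
  have h2 := sum_digit_mul_pow B l h ct.2
  have h3 : RLWE.phase z (extProd B ct (RGSW.encrypt B z m a e)) =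
      m * (∑ j : Fin l, digit B j ct.2 * (B : Rq N Q) ^ (j : ℕ))
        - m * (∑ j : Fin l, digit B j ct.1 * (B : Rq N Q) ^ (j : ℕ)) * z
        + ∑ β : Fin 2, ∑ j : Fin l, digit B j (ct.component β) * e β j := by
    simp only [extProd, RLWE.phase_sum, RLWE.phase_add, RLWE.phase_smul, RGSW.phase_encrypt,
      gadgetPhase, Fin.sum_univ_two, RLWE.component]
    simp only [if_true, one_ne_zero, if_false, Finset.mul_sum, Finset.sum_mul,
      ← Finset.sum_add_distrib, ← Finset.sum_sub_distrib]
    exact Finset.sum_congr rfl fun j _ => by ring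
  rw [h3, h1, h2, RLWE.phase]; ring

end Phase

-- Noise in the accumulation loop

section Accumulation

variable {N Q r l : ℕ} [NeZero N]

/-- The multiple of `a` by which the key of sign `σ` rotates the accumulator. -/
def signedRotation {M : ℕ} (a : ZMod M) (σ : Fin 2) : ZMod M := if σ = 0 then -a else a

/-- The entries that are multiplied with the key of sign `σ` in one round. -/
noncomputable def cmuxDiff (a : ZMod (2 * N * r)) (acc : Fin r → RLWE N Q) (σ : Fin 2) (i : Fin r) : RLWE N Q :=
  act (Phi N Q r (signedRotation a σ)) acc i - acc i

/-- The noise that one round adds to the phases. -/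
noncomputable def cmuxNoise (B : ℕ) (a : ZMod (2 * N * r)) (acc : Fin r → RLWE N Q)
    (e : Fin 2 → Fin 2 → Fin l → Rq N Q) (i : Fin r) : Rq N Q :=
  ∑ σ, ∑ β, ∑ j : Fin l, digit B j ((cmuxDiff a acc σ i).component β) * e σ β j

/-- The two messages `max s 0` and `max (-s) 0`. -/
def signPart (s : ℤ) (σ : Fin 2) : ℤ := if σ = 0 then max s 0 else max (-s) 0

/-- The exponent of `Φ(1)` in `Φ(-a s)` for ternary `s`. -/
def rotationExponent {M : ℕ} (a : ZMod M) (s : ℤ) : ℕ :=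
  if s = 1 then (-a).val else if s = -1 then a.val else 0

/-- For ternary `s` at most one sign part is nonzero, and `1 + s₊(Φ(-a) - 1) + s₋(Φ(a) - 1)` equals
`Φ(-a s)`. -/
theorem phase_cmuxStep [NeZero Q] (B : ℕ) (h : Q ≤ B ^ l) (z : Rq N Q) (s : ℤ)
    (hs : s = -1 ∨ s = 0 ∨ s = 1)
    (m e : Fin 2 → Fin 2 → Fin l → Rq N Q) (a : ZMod (2 * N * r)) (acc : Fin r → RLWE N Q) :
    (fun i => RLWE.phase z (cmuxStep B (RGSW.encrypt B z (signPart s 0 : Rq N Q) (m 0) (e 0))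
        (RGSW.encrypt B z (signPart s 1 : Rq N Q) (m 1) (e 1)) a acc i)) =
      (PhiOne N Q r ^ rotationExponent a s).mulVec (fun i => RLWE.phase z (acc i))
        + cmuxNoise B a acc e := by
  funext i
  simp only [cmuxStep, RLWE.phase_add, phase_extProd_encrypt B h, RLWE.phase_sub, phase_act,
    Pi.add_apply, cmuxNoise, cmuxDiff, Fin.sum_univ_two (M := Rq N Q), signedRotation, if_true,
    one_ne_zero, if_false, Phi]
  rcases hs with rfl | rfl | rfl <;>
    simp [signPart, rotationExponent] <;> ring

/-- The accumulator after `k` rounds. -/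
noncomputable def accAfter (B : ℕ) (C : ℕ → Fin 2 → RGSW N Q l) (a : ℕ → ZMod (2 * N * r))
    (init : Fin r → RLWE N Q) : ℕ → Fin r → RLWE N Q
  | 0 => init
  | k + 1 => cmuxStep B (C k 0) (C k 1) (a k) (accAfter B C a init k)

theorem accAfter_congr (B : ℕ) {C C' : ℕ → Fin 2 → RGSW N Q l} (a : ℕ → ZMod (2 * N * r))
    (init : Fin r → RLWE N Q) (k : ℕ) (h : ∀ j < k, C j = C' j) :
    accAfter B C a init k = accAfter B C' a init k := by
  induction k with
  | zero => rfl
  | succ k ih => rw [accAfter, accAfter, ih fun j hj => h j (by omega), h k (by omega)]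

theorem foldl_eq_of_forall_succ {α : Type*} (n : ℕ) (f : α → Fin n → α) (g : ℕ → α)
    (h : ∀ k : Fin n, g (k + 1) = f (g k) k) : Fin.foldl n f (g 0) = g n := by
  induction n with
  | zero => simp
  | succ n ih =>
    rw [Fin.foldl_succ_last, ih _ fun k => by simpa using h k.castSucc]
    exact (h (Fin.last n)).symm

/-- Applying all rotations still to come gives an expression that changes in each round only by the
transported noise of that round. At `k = n` it is the final phase. -/
theorem phase_accAfter [NeZero Q] (B : ℕ) (h : Q ≤ B ^ l) (z : Rq N Q) (s : ℕ → ℤ)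
    (hs : ∀ k, s k = -1 ∨ s k = 0 ∨ s k = 1)
    (m e : ℕ → Fin 2 → Fin 2 → Fin l → Rq N Q) (a : ℕ → ZMod (2 * N * r))
    (init : Fin r → RLWE N Q) (n k : ℕ) (hk : k ≤ n)
    (C : ℕ → Fin 2 → RGSW N Q l)
    (hC : ∀ k < n, ∀ σ, C k σ = RGSW.encrypt B z (signPart (s k) σ : Rq N Q) (m k σ) (e k σ)) :
    (PhiOne N Q r ^ ∑ j ∈ Finset.Ico k n, rotationExponent (a j) (s j)).mulVec
        (fun i => RLWE.phase z (accAfter B C a init k i)) =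
      (PhiOne N Q r ^ ∑ j ∈ Finset.Ico 0 n, rotationExponent (a j) (s j)).mulVec
        (fun i => RLWE.phase z (init i)) +
      ∑ k' ∈ Finset.range k,
        (PhiOne N Q r ^ ∑ j ∈ Finset.Ico (k' + 1) n, rotationExponent (a j) (s j)).mulVec
          (cmuxNoise B (a k') (accAfter B C a init k') (e k')) := by
  induction k with
  | zero => simp [accAfter]
  | succ k ih =>
    have hkn : k < n := hk
    rw [Finset.sum_range_succ, ← add_assoc, ← ih hkn.le, Finset.sum_eq_sum_Ico_succ_bot hkn]
    simp only [accAfter]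
    rw [hC k hkn, hC k hkn, phase_cmuxStep B h z _ (hs k), Matrix.mulVec_add,
      Matrix.mulVec_mulVec, ← pow_add, add_comm (rotationExponent _ _)]

end Accumulation

-- Evaluation of the test vector

section TestVector

/-- Scaling by `⌊Q/t⌋` is not odd: the representative of `-m` is `t - m`, and `t ⌊Q/t⌋` misses `Q`
by `Q % t`. The `κ` term therefore appears when negacyclicity is used. -/
theorem scaled_neg {t : ℕ} [NeZero t] (Q : ℕ) (m : ZMod t) :
    ∃ κ : ℕ, κ ≤ 1 ∧ -scaled Q (-m) = ((m.val * (Q / t) + κ * (Q % t) : ℕ) : ZMod Q) := by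
  by_cases hm : m = 0
  · exact ⟨0, by simp, by simp [scaled, hm]⟩
  · refine ⟨1, le_rfl, ?_⟩
    have : NeZero m := ⟨hm⟩
    rw [scaled, ZMod.val_neg_of_ne_zero, neg_eq_iff_add_eq_zero, ← Nat.cast_add]
    have h1 : (t - m.val) * (Q / t) + (m.val * (Q / t) + 1 * (Q % t)) = Q := by
      rw [← add_assoc, ← add_mul, Nat.sub_add_cancel m.val_lt.le, one_mul, Nat.div_add_mod]
    rw [h1]; simp

variable {N r : ℕ} [NeZero N] [NeZero r]

theorem coeff_phiOne_pow_testVector {t' : ℕ} [NeZero t'] (Q : ℕ) (f' : ZMod (2 * N * r) → ZMod t')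
    (hf' : IsNegacyclic f') (c : ℕ) :
    ∃ κ : ℕ, κ ≤ 1 ∧ coeff ((PhiOne N Q r ^ c).mulVec (testVector Q f') 0) 0 =
      (((f' c).val * (Q / t') + κ * (Q % t') : ℕ) : ZMod Q) := by
  obtain ⟨a, ha, b, ε, hε, h⟩ := exists_coeff_phiOne_pow_mulVec (N := N) (Q := Q) (r := r) c
  rw [h, testVector, coeff_ofCoeffs _ ⟨a, ha⟩]
  simp only
  rcases hε with ⟨rfl, hd⟩ | ⟨rfl, hd⟩
  · refine ⟨0, by simp, ?_⟩
    have : -((a * r + b : ℕ) : ZMod (2 * N * r)) = c := by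
      rw [neg_eq_iff_add_eq_zero, ← Nat.cast_add, ZMod.natCast_eq_zero_iff, add_comm]
      exact hd
    rw [this]; simp [scaled]
  · have : -((a * r + b : ℕ) : ZMod (2 * N * r)) = c + ((2 * N * r / 2 : ℕ) : ZMod (2 * N * r)) := by
      have e : 2 * N * r / 2 = N * r := by
        rw [mul_assoc, Nat.mul_div_cancel_left _ (by norm_num)]
      rw [neg_eq_iff_add_eq_zero, e, ← Nat.cast_add, ← Nat.cast_add, ZMod.natCast_eq_zero_iff]
      convert hd using 1; ring
    rw [this, hf' c]
    simpa using scaled_neg Q (f' c)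

end TestVector

-- Products of digit and error polynomials

section Coefficients

variable {N Q : ℕ} [NeZero N]

/-- The coefficient of `e_i` in the coefficient of `x^u` of the product of `digit B j a`
with `∑ e_i x^i`. -/
noncomputable def digitCoeff (B j : ℕ) (a : Rq N Q) (u : ℕ) (i : Fin N) : ℤ :=
  if (i : ℕ) ≤ u then (((coeff a (u - i)).val / B ^ j % B : ℕ) : ℤ)
  else -(((coeff a (u + N - i)).val / B ^ j % B : ℕ) : ℤ)

theorem abs_digitCoeff_le (B j : ℕ) (hB : 0 < B) (a : Rq N Q) (u : ℕ) (i : Fin N) :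
    |digitCoeff B j a u i| ≤ B := by
  unfold digitCoeff
  split_ifs
  · rw [Nat.abs_cast]; exact_mod_cast (Nat.mod_lt _ hB).le
  · rw [abs_neg, Nat.abs_cast]; exact_mod_cast (Nat.mod_lt _ hB).le

theorem coeff_digit_mul_ofCoeffs (B j : ℕ) (a : Rq N Q) (e : Fin N → ℤ) (u : ℕ) (hu : u < N) :
    coeff (digit B j a * ofCoeffs fun i => (e i : ZMod Q)) u =
      ((∑ i, digitCoeff B j a u i * e i : ℤ) : ZMod Q) := by
  rw [coeff_mul_ofCoeffs _ _ u hu, Int.cast_sum]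
  refine Finset.sum_congr rfl fun i _ => ?_
  rw [Int.cast_mul, mul_comm, digitCoeff]
  congr 1
  split_ifs with h
  · rw [digit, coeff_ofCoeffs _ ⟨u - i, by omega⟩, Int.cast_natCast]
  · rw [digit, coeff_ofCoeffs _ ⟨u + N - i, by omega⟩, Int.cast_neg, Int.cast_natCast]

end Coefficients

-- Sample extraction and key switching

section KeySwitch

variable {N n Q : ℕ} [NeZero N] [NeZero Q]

theorem phase_sampleExtract (z : Rq N Q) (ct : RLWE N Q) :
    LWE.phase (fun i : Fin N => coeff z i) (sampleExtract ct) = coeff (RLWE.phase z ct) 0 := by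
  rw [LWE.phase, RLWE.phase, coeff_sub]
  conv_rhs => rw [← ofCoeffs_coeff z]
  rw [coeff_mul_ofCoeffs _ _ 0 (NeZero.pos N)]
  simp only [sampleExtract]
  congr 1
  refine Finset.sum_congr rfl fun i _ => ?_
  rw [mul_comm]
  rcases Nat.eq_zero_or_pos (i : ℕ) with h | h
  · simp [h]
  · rw [if_neg (by omega), if_neg (by omega), zero_add]

/-- The digit that selects the key-switching key. -/
def keyDigit (b : ℕ) [NeZero b] (ct : LWE N Q) (i : Fin N) (j : ℕ) : Fin b :=
  Fin.ofNat b ((ct.1 i).val / b ^ j)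

theorem phase_keySwitch {l b : ℕ} [NeZero b] (h : Q ≤ b ^ l) (z : Fin N → ZMod Q)
    (s : Fin n → ZMod Q) (a : Fin N → Fin l → Fin b → Fin n → ZMod Q)
    (e : Fin N → Fin l → Fin b → ZMod Q) (ct : LWE N Q) :
    LWE.phase s (keySwitch (ksKeyGen z s a e) ct) =
      LWE.phase z ct - ∑ i, ∑ j : Fin l, e i j (keyDigit b ct i j) := by
  have h1 : ∀ i, ∑ j : Fin l, z i * (b : ZMod Q) ^ (j : ℕ) * ((keyDigit b ct i j : ℕ) : ZMod Q)
      = ct.1 i * z i := fun i => by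
    conv_rhs => rw [← sum_fin_digits (ct.1 i) b l h]
    rw [Finset.sum_mul]
    refine Finset.sum_congr rfl fun j _ => ?_
    rw [keyDigit, Fin.val_ofNat]; ring
  have h2 : ∑ x, (∑ i, ∑ j : Fin l, a i j (keyDigit b ct i j) x) * s x =
      ∑ i, ∑ j : Fin l, ∑ x, a i j (keyDigit b ct i j) x * s x := by
    simp only [Finset.sum_mul]
    rw [Finset.sum_comm]
    exact Finset.sum_congr rfl fun i _ => Finset.sum_comm
  simp only [LWE.phase, keySwitch, Prod.fst_sub, Prod.snd_sub, Prod.fst_sum, Prod.snd_sum,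
    Pi.sub_apply, Finset.sum_apply, Pi.zero_apply, zero_sub, neg_mul, Finset.sum_neg_distrib]
  have h3 : ∀ i j, ksKeyGen z s a e i j (Fin.ofNat b ((ct.1 i).val / b ^ (j : ℕ))) =
    (a i j (keyDigit b ct i j), (∑ h, a i j (keyDigit b ct i j) h * s h)
      + z i * (b : ZMod Q) ^ (j : ℕ) * ((keyDigit b ct i j : ℕ) : ZMod Q)
      + e i j (keyDigit b ct i j)) := fun i j => rfl
  simp only [h3, Finset.sum_add_distrib, h1, h2]
  ring

theorem keySwitch_fst {l b : ℕ} [NeZero b] (z : Fin N → ZMod Q)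
    (s : Fin n → ZMod Q) (a : Fin N → Fin l → Fin b → Fin n → ZMod Q)
    (e : Fin N → Fin l → Fin b → ZMod Q) (ct : LWE N Q) (x : Fin n) :
    (keySwitch (ksKeyGen z s a e) ct).1 x =
      -∑ i, ∑ j : Fin l, a i j (keyDigit b ct i j) x := by
  simp [keySwitch, Prod.fst_sum, Finset.sum_apply, ksKeyGen, keyDigit]

end KeySwitch

-- Modulus switching and the error representative

section ModSwitch

/-- The error `c q / Q - ⌊c q / Q⌉` of a modulus switch from `Q` to `q`. -/
noncomputable def roundingError {Q : ℕ} (q : ℕ) (c : ZMod Q) : ℝ :=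
  (((c.val : ℚ) * q / Q - round ((c.val : ℚ) * q / Q) : ℚ) : ℝ)

theorem abs_roundingError_le {Q : ℕ} (q : ℕ) (c : ZMod Q) : |roundingError q c| ≤ 1 / 2 := by
  unfold roundingError
  rw [← Rat.cast_abs]
  have := (Rat.cast_le (K := ℝ)).2 (abs_sub_round ((c.val : ℚ) * q / Q))
  simpa only [Rat.cast_div, Rat.cast_one, Rat.cast_ofNat] using this

theorem exists_phase_modSwitch {n q Q : ℕ} [NeZero Q] (s : Fin n → ℤ) (ct : LWE n Q) (P : ℤ)
    (hP : LWE.phase (fun k => (s k : ZMod Q)) ct = P) :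
    ∃ y : ℤ, LWE.phase (fun k => (s k : ZMod q)) (modSwitch q ct) = y ∧
      |(y : ℝ) - ((q : ℝ) / Q * P + ∑ k, s k * roundingError q (ct.1 k))| ≤ 1 / 2 := by
  have h1 : ((ct.2.val : ℤ) - P - ∑ k, ((ct.1 k).val : ℤ) * s k : ℤ) ≡ 0 [ZMOD Q] := by
    rw [← ZMod.intCast_eq_intCast_iff]
    push_cast
    simp only [ZMod.natCast_val, ZMod.cast_id', id, ← hP, LWE.phase]
    ring
  -- The integer `w` measures the wrap-around modulo `Q` of the lifted phase. After scaling it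
  -- becomes `q w`, which vanishes modulo `q`, so only the roundings are left.
  obtain ⟨w, hw⟩ := h1.symm.dvd
  refine ⟨round ((ct.2.val : ℚ) * q / Q) - ∑ k, round (((ct.1 k).val : ℚ) * q / Q) * s k - q * w,
    ?_, ?_⟩
  · simp [LWE.phase, modSwitch, switchCoord]
  · have hQ : (Q : ℝ) ≠ 0 := Nat.cast_ne_zero.2 (NeZero.ne Q)
    have hw' : (ct.2.val : ℝ) - P - ∑ k, ((ct.1 k).val : ℝ) * s k = Q * w := by
      have := congrArg (Int.cast : ℤ → ℝ) hw
      push_cast at this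
      linarith
    have h2 : ∑ k, (s k : ℝ) * roundingError q (ct.1 k) =
        (q : ℝ) / Q * ∑ k, ((ct.1 k).val : ℝ) * s k -
          ∑ k, (round (((ct.1 k).val : ℚ) * q / Q) : ℝ) * s k := by
      rw [Finset.mul_sum, ← Finset.sum_sub_distrib]
      refine Finset.sum_congr rfl fun k _ => ?_
      rw [roundingError]; push_cast; ring
    have h3 : (q : ℝ) * w = q / Q * (ct.2.val - P - ∑ k, ((ct.1 k).val : ℝ) * s k) := by
      rw [hw']; field_simp
    have h4 := abs_roundingError_le q ct.2
    rw [roundingError] at h4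
    rw [h2]
    push_cast at h4 ⊢
    rw [h3, abs_sub_comm]
    convert h4 using 2
    ring

/-- The representative in `(-q/2, q/2]` is the smallest in absolute value of its class, so any
integer lift bounds it and no wrap-around modulo `q` has to be excluded. -/
theorem abs_error_le {n q t : ℕ} [NeZero q] (s : Fin n → ZMod q) (m : ZMod t) (ct : LWE n q)
    (y : ℤ) (h : ct.phase s = y) :
    |(LWE.error s m ct : ℝ)| ≤ |(y : ℝ) - (m.val * (q / t) : ℕ)| := by
  have hx : ct.phase s - scaled q m = ((y - (m.val * (q / t) : ℕ) : ℤ) : ZMod q) := by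
    rw [h, scaled, Int.cast_sub, Int.cast_natCast]
  have key : |LWE.error s m ct| ≤ |y - (m.val * (q / t) : ℕ)| := by
    rw [LWE.error, hx]
    set w : ℤ := y - (m.val * (q / t) : ℕ)
    have h1 := ZMod.valMinAbs_mem_Ioc (w : ZMod q)
    have h2 : (((w : ZMod q).valMinAbs : ℤ) : ZMod q) = w := ZMod.coe_valMinAbs _
    set v := (w : ZMod q).valMinAbs
    obtain ⟨c, hc⟩ := ((ZMod.intCast_eq_intCast_iff _ _ _).1 h2).dvd
    obtain ⟨h3, h4⟩ := h1
    rcases eq_or_ne c 0 with rfl | hc0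
    · have : w = v := by linarith
      rw [this]
    · have h5 : 1 ≤ |c| := Int.one_le_abs hc0
      have h6 : |w - v| = q * |c| := by rw [hc, abs_mul, Nat.abs_cast]
      have h7 : |w - v| ≤ |w| + |v| := abs_sub _ _
      have h8 : 2 * |v| ≤ q := by
        rcases abs_cases v with ⟨h, _⟩ | ⟨h, _⟩ <;> rw [h] <;> linarith
      have h9 : (q : ℤ) ≤ q * |c| := by nlinarith [Int.natCast_nonneg q]
      linarith
  have := (Int.cast_le (R := ℝ)).2 key
  push_cast at this ⊢
  exact this

end ModSwitch

-- The output error as a linear form in the key errors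

section Boot

/-- The extension of a tuple to all natural numbers by `d`. -/
def extendTuple {α : Type*} {n : ℕ} (d : α) (x : Fin n → α) (k : ℕ) : α :=
  if h : k < n then x ⟨k, h⟩ else d

theorem extendTuple_of_lt {α : Type*} {n : ℕ} (d : α) (x : Fin n → α) (k : ℕ) (h : k < n) :
    extendTuple d x k = x ⟨k, h⟩ := dif_pos h

theorem extendTuple_val {α : Type*} {n : ℕ} (d : α) (x : Fin n → α) (k : Fin n) :
    extendTuple d x k = x k := dif_pos k.2

variable {n N Q r l t' : ℕ} [NeZero N] [NeZero Q] [NeZero r] [NeZero t']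

theorem natCast_rotationExponent {M : ℕ} [NeZero M] (a : ZMod M) (s : ℤ)
    (hs : s = -1 ∨ s = 0 ∨ s = 1) : (rotationExponent a s : ZMod M) = -(a * s) := by
  rcases hs with rfl | rfl | rfl <;> simp [rotationExponent]

/-- The bootstrapping keys as RGSW ciphertexts, indexed by the natural numbers. -/
noncomputable def roundKeys (B : ℕ) (s : Fin n → ℤ) (z : Rq N Q) (m : BKIdx n N l → ZMod Q)
    (e : BKIdx n N l → ℤ) (k : ℕ) (σ : Fin 2) : RGSW N Q l :=
  RGSW.encrypt B z (signPart (extendTuple 0 s k) σ : Rq N Q)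
    (fun β j => ofCoeffs fun i => extendTuple 0 (fun k => m (k, σ, β, j, i)) k)
    (fun β j => ofCoeffs fun i => ((extendTuple 0 (fun k => e (k, σ, β, j, i)) k : ℤ) : ZMod Q))

/-- The coefficient of an error of round `k` is a signed digit of the accumulator before that round,
hence at most `B` in absolute value and a function of the masks and of earlier errors only. The
number `κ` is chosen before the keys, since the total rotation does not involve them. -/
theorem exists_bootCoeff (B : ℕ) (hB : 0 < B) (hQ : Q ≤ B ^ l) (s : Fin n → ℤ)
    (hs : ∀ k, s k = -1 ∨ s k = 0 ∨ s k = 1) (z : Rq N Q) (f' : ZMod (2 * N * r) → ZMod t')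
    (hf' : IsNegacyclic f') (ct : LWE n (2 * N * r)) :
    ∃ κ : ℕ, κ ≤ 1 ∧ ∃ c : (BKIdx n N l → ZMod Q) → (BKIdx n N l → ℤ) → BKIdx n N l → ℤ,
      (∀ m e i, |c m e i| ≤ B) ∧
      (∀ m e e' i, (∀ i', i'.1 < i.1 → e i' = e' i') → c m e i = c m e' i) ∧
      ∀ (m : BKIdx n N l → ZMod Q) (e : BKIdx n N l → ℤ) (bk : Fin n → Fin 2 → RGSW N Q l),
        (∀ k σ, bk k σ = RGSW.encrypt B z (signPart (s k) σ : Rq N Q)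
          (fun β j => ofCoeffs fun i => m (k, σ, β, j, i))
          (fun β j => ofCoeffs fun i => (e (k, σ, β, j, i) : ZMod Q))) →
        coeff (RLWE.phase z (accumulate B bk f' ct 0)) 0 =
          (((f' (ct.phase fun k => (s k : ZMod (2 * N * r)))).val * (Q / t') + κ * (Q % t') : ℕ) :
            ZMod Q) + ((∑ i, c m e i * e i : ℤ) : ZMod Q) := by
  have hM : NeZero (2 * N * r) := ⟨by simp [NeZero.ne]⟩
  set a : ℕ → ZMod (2 * N * r) := extendTuple 0 ct.1 with ha
  set sN : ℕ → ℤ := extendTuple 0 s with hsN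
  set init : Fin r → RLWE N Q := act (Phi N Q r ct.2) fun i => (0, testVector Q f' i) with hinit
  have hsN' : ∀ k, sN k = -1 ∨ sN k = 0 ∨ sN k = 1 := fun k => by
    by_cases h : k < n
    · rw [hsN, extendTuple_of_lt _ _ _ h]; exact hs _
    · right; left; exact dif_neg h
  set T : ℕ → ℕ := fun k => ∑ j ∈ Finset.Ico k n, rotationExponent (a j) (sN j) with hT
  -- The exponent starts at `k + 1`: noise born in round `k` is rotated only by later rounds. It is
  -- read off at one position, with one sign.
  have hfun := fun k => exists_coeff_phiOne_pow_mulVec (N := N) (Q := Q) (r := r) (T (k + 1))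
  choose pos hpos row ε hε hrow using hfun
  obtain ⟨κ, hκ, hv⟩ := coeff_phiOne_pow_testVector (N := N) (r := r) Q f' hf' (T 0 + ct.2.val)
  set acc : (BKIdx n N l → ZMod Q) → (BKIdx n N l → ℤ) → ℕ → Fin r → RLWE N Q := fun m e =>
    accAfter B (roundKeys B s z m e) a init with hacc
  refine ⟨κ, hκ, fun m e i => ε i.1 * digitCoeff B i.2.2.2.1
    ((cmuxDiff (a i.1) (acc m e i.1) i.2.1 (row i.1)).component i.2.2.1) (pos i.1) i.2.2.2.2,
    ?_, ?_, ?_⟩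
  · intro m e i
    have : |ε i.1| = 1 := by
      rcases hε i.1 with ⟨h, _⟩ | ⟨h, _⟩ <;> simp [h]
    rw [abs_mul, this, one_mul]
    exact abs_digitCoeff_le B _ hB _ _ _
  · intro m e e' i h
    have : acc m e i.1 = acc m e' i.1 := by
      refine accAfter_congr B a init _ fun j hj => ?_
      have hjn : j < n := hj.trans i.1.2
      funext σ
      simp only [roundKeys, extendTuple_of_lt _ _ _ hjn]
      congr 1
      funext β j'
      congr 1
      funext i'
      rw [h _ hj]
    simp only [this]
  · intro m e bk hbk
    set eN : ℕ → Fin 2 → Fin 2 → Fin l → Rq N Q := fun k σ β j =>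
      ofCoeffs fun i => ((extendTuple 0 (fun k => e (k, σ, β, j, i)) k : ℤ) : ZMod Q) with heN
    have h1 : accumulate B bk f' ct = acc m e n := by
      refine foldl_eq_of_forall_succ n _ (acc m e) fun k => ?_
      have hk : ∀ σ, roundKeys B s z m e k σ = bk k σ := fun σ => by
        rw [hbk]; simp only [roundKeys, extendTuple_val]
      simp only [hacc, accAfter, hk, ha, extendTuple_val]
    have h2 := phase_accAfter B hQ z sN hsN'
      (fun k σ β j => ofCoeffs fun i => extendTuple 0 (fun k => m (k, σ, β, j, i)) k) eN
      a init n n le_rfl (roundKeys B s z m e) fun k _ σ => rfl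
    have h3 : (fun i => RLWE.phase z (init i)) =
        (PhiOne N Q r ^ ct.2.val).mulVec (testVector Q f') := by
      funext i
      rw [hinit, phase_act]
      simp [RLWE.phase, Phi]
    have h4 := congrArg (fun w => coeff (w 0) 0) h2
    simp only [Finset.Ico_self, Finset.sum_empty, pow_zero, Matrix.one_mulVec, h3,
      Matrix.mulVec_mulVec, ← pow_add, Pi.add_apply, coeff_add, Finset.sum_apply, coeff_sum] at h4
    rw [h1, h4]
    have h5 : ((T 0 + ct.2.val : ℕ) : ZMod (2 * N * r)) =
        ct.phase fun k => (s k : ZMod (2 * N * r)) := by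
      rw [hT, LWE.phase]
      simp only [Nat.Ico_zero_eq_range, Finset.sum_range, Nat.cast_add, Nat.cast_sum,
        ha, hsN, extendTuple_val, ZMod.natCast_val, ZMod.cast_id', id]
      simp only [natCast_rotationExponent _ _ (hs _), Finset.sum_neg_distrib]
      ring
    rw [hv, h5]
    congr 1
    rw [Finset.sum_range]
    simp only [Fintype.sum_prod_type]
    rw [Int.cast_sum]
    refine Finset.sum_congr rfl fun k _ => ?_
    rw [hrow]
    simp only [cmuxNoise, coeff_sum, Int.cast_sum, Finset.mul_sum]
    refine Finset.sum_congr rfl fun σ _ => Finset.sum_congr rfl fun β _ =>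
      Finset.sum_congr rfl fun j _ => ?_
    simp only [heN, extendTuple_val]
    rw [coeff_digit_mul_ofCoeffs _ _ _ _ _ (hpos k), Int.cast_sum, Finset.mul_sum]
    refine Finset.sum_congr rfl fun i _ => ?_
    push_cast; ring

variable {q t lKS BKS : ℕ} [NeZero q] [NeZero t] [NeZero BKS]

/-- Replacing each floor by (number minus remainder) over `t'` cancels the main terms. The rest is
`p (y - x) + κ x` with `p = v/t'` in `[0, 1]` and both scaled remainders `x`, `y` in `[0, K]`. -/
theorem abs_scaling_error_le {K : ℝ} {q Q t' : ℕ} (hq : 0 < q) (hQ : 0 < Q) (ht' : 0 < t') (v κ : ℕ)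
    (hv : v < t') (hκ : κ ≤ 1) (h1 : ((Q % t' : ℕ) * q : ℝ) ≤ K * Q) (h2 : ((q % t' : ℕ) : ℝ) ≤ K) :
    |(q : ℝ) / Q * (v * (Q / t' : ℕ) + κ * (Q % t' : ℕ)) - v * (q / t' : ℕ)| ≤ 2 * K := by
  have hQ' : (0 : ℝ) < Q := by exact_mod_cast hQ
  have ht : (0 : ℝ) < t' := by exact_mod_cast ht'
  have eQ : ((Q / t' : ℕ) : ℝ) = (Q - (Q % t' : ℕ)) / t' := by
    rw [eq_div_iff ht.ne', eq_sub_iff_add_eq]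
    exact_mod_cast Nat.div_add_mod' Q t'
  have eq : ((q / t' : ℕ) : ℝ) = (q - (q % t' : ℕ)) / t' := by
    rw [eq_div_iff ht.ne', eq_sub_iff_add_eq]
    exact_mod_cast Nat.div_add_mod' q t'
  set x : ℝ := (q : ℝ) / Q * (Q % t' : ℕ) with hx
  have hx0 : 0 ≤ x := by positivity
  have hx1 : x ≤ K := by
    rw [hx, div_mul_eq_mul_div, div_le_iff₀ hQ', mul_comm (q : ℝ)]; exact h1
  set y : ℝ := ((q % t' : ℕ) : ℝ)
  have hy0 : 0 ≤ y := by positivity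
  set p : ℝ := (v : ℝ) / t' with hp
  have hp0 : 0 ≤ p := by positivity
  have hp1 : p ≤ 1 := by
    rw [hp, div_le_one ht]; exact_mod_cast hv.le
  have hk0 : (0 : ℝ) ≤ κ := by positivity
  have hk1 : (κ : ℝ) ≤ 1 := by exact_mod_cast hκ
  have key : (q : ℝ) / Q * (v * (Q / t' : ℕ) + κ * (Q % t' : ℕ)) - v * (q / t' : ℕ) =
      p * (y - x) + κ * x := by
    rw [eQ, eq, hx, hp]; field_simp; ring
  rw [key, abs_le]
  constructor <;> nlinarith [mul_nonneg hp0 hx0, mul_nonneg hp0 hy0, mul_nonneg hk0 hx0,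
    mul_le_mul_of_nonneg_right hp1 hx0, mul_le_mul_of_nonneg_right hp1 hy0,
    mul_le_mul_of_nonneg_right hk1 hx0]

/-- A scaled sum of errors of the bootstrapping keys with coefficients `c` and of the errors of the
key-switching keys selected by `d`, plus the rounding errors of the sums of the selected masks. -/
noncomputable def linearError (q : ℕ) (s : Fin n → ℤ)
    (c : (BKIdx n N l → ZMod Q) → (BKIdx n N l → ℤ) → BKIdx n N l → ℤ)
    (d : (BKIdx n N l → ZMod Q) → (BKIdx n N l → ℤ) → Fin N → Fin lKS → Fin BKS)
    (mask : MaskIdx n N l lKS BKS → ZMod Q) (err : ErrIdx n N l lKS BKS → ℤ) : ℝ :=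
  (q : ℝ) / Q * (∑ i, c (mask ∘ Sum.inl) (err ∘ Sum.inl) i * err (Sum.inl i)
      - ∑ i, ∑ j, err (Sum.inr (i, j, d (mask ∘ Sum.inl) (err ∘ Sum.inl) i j)) : ℤ)
    + ∑ h, s h * roundingError q (-∑ i, ∑ j,
        mask (Sum.inr ((i, j, d (mask ∘ Sum.inl) (err ∘ Sum.inl) i j), h)))

/-- The error of the output is, up to a bounded amount, at most a `linearError` whose coefficients for the
bootstrapping keys are bounded and only depend on the errors of earlier keys. -/
theorem exists_boot_error (K : ℝ) (B : ℕ) (hB : 0 < B) (hQ : Q ≤ B ^ l) (hQ' : Q ≤ BKS ^ lKS)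
    (h1 : ((Q % t' : ℕ) * q : ℝ) ≤ K * Q) (h2 : ((q % t' : ℕ) : ℝ) ≤ K)
    (f : ZMod t → ZMod t') (f' : ZMod (2 * N * r) → ZMod t') (hf' : IsNegacyclicExtension f f')
    (s : Fin n → ℤ) (hs : ∀ k, s k = -1 ∨ s k = 0 ∨ s k = 1) (z : Rq N Q) (ct : LWE n q)
    (m : ZMod t) (hct : LWE.DecryptsTo (fun k => (s k : ZMod (2 * N * r))) m
      (modSwitch (2 * N * r) ct)) :
    ∃ (c : (BKIdx n N l → ZMod Q) → (BKIdx n N l → ℤ) → BKIdx n N l → ℤ)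
      (d : (BKIdx n N l → ZMod Q) → (BKIdx n N l → ℤ) → Fin N → Fin lKS → Fin BKS),
      (∀ m e i, |c m e i| ≤ B) ∧
      (∀ m e e' i, (∀ i', i'.1 < i.1 → e i' = e' i') → c m e i = c m e' i) ∧
      ∀ (mask : MaskIdx n N l lKS BKS → ZMod Q) (err : ErrIdx n N l lKS BKS → ℤ),
        |(LWE.error (fun k => (s k : ZMod q)) (f m)
            (boot B (bootKeys B s z mask err) (switchKeys s z mask err) f' ct) : ℝ)| ≤
          |linearError q s c d mask err| + (2 * K + 1 / 2) := by
  obtain ⟨κ, hκ, c, hc1, hc2, hc3⟩ := exists_bootCoeff B hB hQ s hs z f' hf'.1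
    (modSwitch (2 * N * r) ct)
  have hphase : f' (LWE.phase (fun k => (s k : ZMod (2 * N * r))) (modSwitch (2 * N * r) ct)) =
      f m := by
    obtain ⟨e, he, he'⟩ := hct
    rw [he', hf'.2 m e he]
  set bkOf : (BKIdx n N l → ZMod Q) → (BKIdx n N l → ℤ) → Fin n → Fin 2 → RGSW N Q l :=
    fun m e k σ => RGSW.encrypt B z (signPart (s k) σ : Rq N Q)
          (fun β j => ofCoeffs fun i => m (k, σ, β, j, i))
          (fun β j => ofCoeffs fun i => (e (k, σ, β, j, i) : ZMod Q)) with hbkOf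
  refine ⟨c, fun m e i j => keyDigit BKS (sampleExtract
    (accumulate B (bkOf m e) f' (modSwitch (2 * N * r) ct) 0)) i j, hc1, hc2, ?_⟩
  intro mask err
  rw [linearError]
  have hbk : bootKeys B s z mask err = bkOf (mask ∘ Sum.inl) (err ∘ Sum.inl) := rfl
  set acc := accumulate B (bkOf (mask ∘ Sum.inl) (err ∘ Sum.inl)) f' (modSwitch (2 * N * r) ct)
    with hacc
  have h3 := hc3 (mask ∘ Sum.inl) (err ∘ Sum.inl) (bkOf (mask ∘ Sum.inl) (err ∘ Sum.inl))
    fun k σ => rfl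
  rw [hphase, ← hacc] at h3
  set ks := keySwitch (switchKeys s z mask err) (sampleExtract (acc 0)) with hks
  set E : ℤ := (∑ i, c (mask ∘ Sum.inl) (err ∘ Sum.inl) i * err (Sum.inl i)
    - ∑ i, ∑ j : Fin lKS, err (Sum.inr (i, j, keyDigit BKS (sampleExtract (acc 0)) i j))) with hE
  have h4 : LWE.phase (fun k => (s k : ZMod Q)) ks =
      ((((f m).val * (Q / t') + κ * (Q % t') : ℕ) : ℤ) + E : ℤ) := by
    rw [hks, switchKeys, phase_keySwitch hQ', phase_sampleExtract, h3]
    simp only [hE, Int.cast_add, Int.cast_sub, Int.cast_sum, Function.comp, Int.cast_natCast]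
    ring
  obtain ⟨y, hy1, hy2⟩ := exists_phase_modSwitch (q := q) s ks _ h4
  have h5 : boot B (bootKeys B s z mask err) (switchKeys s z mask err) f' ct = modSwitch q ks := rfl
  rw [h5]
  refine (abs_error_le _ (f m) _ y hy1).trans ?_
  have h6 : ∀ h, ks.1 h = -∑ i, ∑ j : Fin lKS,
      mask (Sum.inr ((i, j, keyDigit BKS (sampleExtract (acc 0)) i j), h)) := fun h => by
    rw [hks, switchKeys, keySwitch_fst]
  simp only [h6] at hy2
  have h7 := abs_scaling_error_le (NeZero.pos q) (NeZero.pos Q) (NeZero.pos t') (f m).val κ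
    (f m).val_lt hκ h1 h2
  set R : ℝ := ∑ h, s h * roundingError q (-∑ i, ∑ j : Fin lKS,
      mask (Sum.inr ((i, j, keyDigit BKS (sampleExtract (acc 0)) i j), h))) with hR
  -- Three contributions: the linear error with the mask roundings, the rounding of the body
  -- (`1/2`), and the floors in the scaling (`2K`).
  have h8 : (y : ℝ) - ((f m).val * (q / t') : ℕ) = ((q : ℝ) / Q * E + R) +
      ((y - ((q : ℝ) / Q * (((((f m).val * (Q / t') + κ * (Q % t') : ℕ) : ℤ) + E : ℤ) : ℝ) + R)) +
      ((q : ℝ) / Q * ((f m).val * (Q / t' : ℕ) + κ * (Q % t' : ℕ)) -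
        (f m).val * (q / t' : ℕ))) := by
    have hcast : (((((f m).val * (Q / t') + κ * (Q % t') : ℕ) : ℤ) + E : ℤ) : ℝ) =
        ((f m).val * (Q / t' : ℕ) + κ * (Q % t' : ℕ)) + E := by
      rw [Int.cast_add, Int.cast_natCast, Nat.cast_add, Nat.cast_mul, Nat.cast_mul]
    rw [hcast, Nat.cast_mul]; ring
  rw [h8]
  refine (abs_add_le _ _).trans (add_le_add le_rfl ((abs_add_le _ _).trans ?_))
  rw [add_comm]
  exact add_le_add h7 hy2

end Boot

-- Rounding errors of uniform masks

section Rounding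

theorem six_pow_mul_factorial_le (n : ℕ) : 6 ^ n * n.factorial ≤ (2 * n + 1).factorial := by
  induction n with
  | zero => simp
  | succ n ih =>
    have h : 2 * (n + 1) + 1 = (2 * n + 1) + 1 + 1 := by ring
    rw [h, Nat.factorial_succ (2 * n + 1 + 1), Nat.factorial_succ (2 * n + 1),
      Nat.factorial_succ n, pow_succ]
    calc 6 ^ n * 6 * ((n + 1) * n.factorial) = (6 * (n + 1)) * (6 ^ n * n.factorial) := by ring
      _ ≤ ((2 * n + 1 + 1 + 1) * (2 * n + 1 + 1)) * (2 * n + 1).factorial :=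
        Nat.mul_le_mul (by nlinarith) ih
      _ = _ := by ring

/-- The power series compare term by term, by `6^i i! ≤ (2i+1)!`. The constant `6` is what yields
the variance `1/12` of a uniform variable on an interval of length one. -/
theorem sinh_le_mul_exp {x : ℝ} (hx : 0 ≤ x) : Real.sinh x ≤ x * Real.exp (x ^ 2 / 6) := by
  rw [Real.sinh_eq_tsum, Real.exp_eq_exp_ℝ, NormedSpace.exp_eq_tsum ℝ, ← tsum_mul_left]
  refine x.hasSum_sinh.summable.tsum_le_tsum (fun i ↦ ?_)
    ((NormedSpace.expSeries_summable' (x ^ 2 / 6)).mul_left x)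
  have h : ((6 ^ i * i.factorial : ℕ) : ℝ) ≤ (2 * i + 1).factorial := by
    exact_mod_cast six_pow_mul_factorial_le i
  have h0 : (0 : ℝ) < (6 ^ i * i.factorial : ℕ) := by positivity
  calc x ^ (2 * i + 1) / (2 * i + 1).factorial ≤ x ^ (2 * i + 1) / (6 ^ i * i.factorial : ℕ) := by
        gcongr
    _ = _ := by
        simp only [smul_eq_mul, div_pow]
        push_cast
        rw [pow_succ, pow_mul]
        field_simp

theorem sum_exp_mul_sinh (m : ℕ) (θ : ℝ) :
    (∑ j ∈ Finset.range m, Real.exp (θ * (2 * j - m + 1))) * Real.sinh θ = Real.sinh (m * θ) := by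
  have h : ∀ k : ℕ, (∑ j ∈ Finset.range k, Real.exp (θ * (2 * j - m + 1))) * Real.sinh θ =
      (Real.exp (θ * (2 * k - m)) - Real.exp (-(m * θ))) / 2 := by
    intro k
    induction k with
    | zero =>
      have : θ * (2 * (0 : ℕ) - m) = -(m * θ) := by push_cast; ring
      rw [this]; simp
    | succ k ih =>
      rw [Finset.sum_range_succ, add_mul, ih, Real.sinh_eq]
      have e1 : Real.exp (θ * (2 * (k + 1 : ℕ) - m)) =
          Real.exp (θ * (2 * k - m + 1)) * Real.exp θ := by
        rw [← Real.exp_add]; congr 1; push_cast; ring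
      have e2 : Real.exp (θ * (2 * k - m)) =
          Real.exp (θ * (2 * k - m + 1)) * Real.exp (-θ) := by
        rw [← Real.exp_add]; congr 1; ring
      rw [e1, e2]; ring
  rw [h m, Real.sinh_eq]
  congr 3; ring

/-- For `t ≠ 0`, the sum over the symmetric grid of step `1/m` is geometric and equals `sinh (mθ) /
sinh θ` with `θ = t/(2m)`. Since `sinh |θ| ≥ |θ|` and `mθ = t/2`, the exponent is `(t/2)²/6 =
t²/24`. -/
theorem sum_exp_centered_le (m : ℕ) (hm : 0 < m) (t : ℝ) :
    ∑ j ∈ Finset.range m, Real.exp (t * ((2 * j - m + 1) / (2 * m))) ≤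
      m * Real.exp (t ^ 2 / 24) := by
  have hm' : (0 : ℝ) < m := by exact_mod_cast hm
  rcases eq_or_ne t 0 with rfl | ht
  · simp
  set θ : ℝ := t / (2 * m) with hθ
  have hθ0 : 0 < |θ| := abs_pos.2 (by rw [hθ]; positivity)
  have hsum : ∑ j ∈ Finset.range m, Real.exp (t * ((2 * j - m + 1) / (2 * m))) =
      ∑ j ∈ Finset.range m, Real.exp (θ * (2 * j - m + 1)) :=
    Finset.sum_congr rfl fun j _ => by rw [hθ]; congr 1; ring
  rw [hsum]
  set S := ∑ j ∈ Finset.range m, Real.exp (θ * (2 * j - m + 1)) with hS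
  have hS0 : 0 ≤ S := Finset.sum_nonneg fun j _ => (Real.exp_pos _).le
  have h1 : S * Real.sinh |θ| = Real.sinh (m * |θ|) := by
    rcases abs_cases θ with ⟨h, _⟩ | ⟨h, _⟩
    · rw [h, hS, sum_exp_mul_sinh]
    · rw [h, mul_neg, Real.sinh_neg, Real.sinh_neg, mul_neg, hS, sum_exp_mul_sinh]
  have h2 : S * |θ| ≤ (m * Real.exp (t ^ 2 / 24)) * |θ| := by
    calc S * |θ| ≤ S * Real.sinh |θ| :=
          mul_le_mul_of_nonneg_left (Real.self_le_sinh_iff.2 hθ0.le) hS0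
      _ = Real.sinh (m * |θ|) := h1
      _ ≤ m * |θ| * Real.exp ((m * |θ|) ^ 2 / 6) := sinh_le_mul_exp (by positivity)
      _ = _ := by
          have : (m * |θ|) ^ 2 / 6 = t ^ 2 / 24 := by
            rw [mul_pow, sq_abs, hθ]; field_simp; norm_num
          rw [this]; ring
  exact le_of_mul_le_mul_right h2 hθ0

/-- A surjective homomorphism of finite groups maps the uniform distribution to the uniform one:
translate by every `b` and exchange the two sums. -/
theorem sum_comp_addMonoidHom {A B : Type*} [AddCommGroup A] [AddCommGroup B] [Fintype A]
    [Fintype B] (φ : A →+ B) (hφ : Function.Surjective φ) (G : B → ℝ) :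
    (∑ a, G (φ a)) * Fintype.card B = Fintype.card A * ∑ b, G b := by
  have h1 : ∀ b, ∑ a, G (φ a + b) = ∑ a, G (φ a) := fun b => by
    obtain ⟨a₀, rfl⟩ := hφ b
    simp only [← map_add]
    exact Equiv.sum_comp (Equiv.addRight a₀) fun a => G (φ a)
  have h2 : ∀ a, ∑ b, G (φ a + b) = ∑ b, G b := fun a => Equiv.sum_comp (Equiv.addLeft (φ a)) G
  calc (∑ a, G (φ a)) * Fintype.card B = ∑ b : B, ∑ a, G (φ a + b) := by
        simp [h1, mul_comm]
    _ = ∑ a, ∑ b, G (φ a + b) := Finset.sum_comm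
    _ = _ := by simp [h2]

theorem round_natCast_div {m c : ℕ} (hc : c < m) :
    round ((c : ℚ) / m) = if 2 * c < m then 0 else 1 := by
  have hm : (0 : ℚ) < m := by exact_mod_cast (Nat.zero_le c).trans_lt hc
  have hc' : (c : ℚ) < m := by exact_mod_cast hc
  rw [round_eq, Int.floor_eq_iff]
  split_ifs with h
  · have h' : (2 : ℚ) * c < m := by exact_mod_cast h
    constructor
    · simp only [Int.cast_zero]; positivity
    · have : (c : ℚ) / m < 1 / 2 := by rw [div_lt_iff₀ hm]; linarith
      simp only [Int.cast_zero]; linarith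
  · have h' : (m : ℚ) ≤ 2 * c := by exact_mod_cast not_lt.1 h
    constructor
    · have : (1 : ℚ) / 2 ≤ c / m := by rw [le_div_iff₀ hm]; linarith
      simp only [Int.cast_one]; linarith
    · have : (c : ℚ) / m < 1 := by rw [div_lt_iff₀ hm]; linarith
      simp only [Int.cast_one]; linarith

/-- The rounding errors run through `(j - ⌊m/2⌋)/m`. For odd `m` this is the symmetric grid; for
even `m` the upward ties shift it by `-1/(2m)`, whence the linear term. -/
theorem sum_exp_fract_le (m : ℕ) [NeZero m] (t : ℝ) :
    ∑ c : ZMod m, Real.exp (t * (((c.val : ℚ) / m - round ((c.val : ℚ) / m) : ℚ) : ℝ)) ≤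
      m * Real.exp (t ^ 2 / 24 + |t| / (2 * m)) := by
  have hm : 0 < m := NeZero.pos m
  have hm' : (0 : ℝ) < m := by exact_mod_cast hm
  set F : ℕ → ℝ := fun c => Real.exp (t * (((c : ℚ) / m - round ((c : ℚ) / m) : ℚ) : ℝ)) with hF
  have h0 : ∑ c : ZMod m, F c.val = ∑ c ∈ Finset.range m, F c := by
    obtain ⟨k, rfl⟩ : ∃ k, m = k + 1 := Nat.exists_eq_succ_of_ne_zero hm.ne'
    rw [Finset.sum_range]; rfl
  set p := m / 2 with hp
  set h := m - p with hh
  have hle : p ≤ m := Nat.div_le_self _ _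
  set G : ℕ → ℝ := fun j => Real.exp (t * (((j : ℝ) - p) / m)) with hG
  have h1 : ∑ c ∈ Finset.range m, F c = ∑ j ∈ Finset.range m, G j := by
    have e1 : m = h + p := by omega
    have e2 : m = p + h := by omega
    conv_lhs => rw [e1, Finset.sum_range_add]
    conv_rhs => rw [e2, Finset.sum_range_add, add_comm]
    congr 1
    · refine Finset.sum_congr rfl fun c hc => ?_
      have hc := Finset.mem_range.1 hc
      simp only [hF, hG]
      rw [round_natCast_div (by omega), if_pos (by omega)]
      push_cast; congr 2; ring
    · refine Finset.sum_congr rfl fun c hc => ?_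
      have hc := Finset.mem_range.1 hc
      simp only [hF, hG]
      rw [round_natCast_div (by omega), if_neg (by omega)]
      have : (m : ℝ) = h + p := by exact_mod_cast e1
      push_cast; congr 2
      field_simp; rw [this]; ring
  have h2 : ∀ j : ℕ, G j ≤ Real.exp (t * ((2 * j - m + 1) / (2 * m))) * Real.exp (|t| / (2 * m)) := by
    intro j
    rw [hG, ← Real.exp_add]
    refine Real.exp_le_exp.2 ?_
    have e : t * (((j : ℝ) - p) / m) = t * ((2 * j - m + 1) / (2 * m)) +
        (t * (m - 1 - 2 * p)) / (2 * m) := by field_simp; ring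
    rw [e]
    gcongr
    rcases Nat.mod_two_eq_zero_or_one m with hmod | hmod
    · have : (m : ℝ) = 2 * p := by
        have : m = 2 * p := by omega
        exact_mod_cast this
      rw [this]; linarith [neg_abs_le t]
    · have : (m : ℝ) = 2 * p + 1 := by
        have : m = 2 * p + 1 := by omega
        exact_mod_cast this
      rw [this]; ring_nf; exact abs_nonneg t
  calc ∑ c : ZMod m, F c.val = ∑ j ∈ Finset.range m, G j := h0.trans h1
    _ ≤ ∑ j ∈ Finset.range m, Real.exp (t * ((2 * j - m + 1) / (2 * m))) *
          Real.exp (|t| / (2 * m)) := Finset.sum_le_sum fun j _ => h2 j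
    _ ≤ m * Real.exp (t ^ 2 / 24) * Real.exp (|t| / (2 * m)) := by
        rw [← Finset.sum_mul]
        exact mul_le_mul_of_nonneg_right (sum_exp_centered_le m hm t) (Real.exp_pos _).le
    _ = _ := by rw [Real.exp_add]; ring

/-- Put `m = Q / gcd(q, Q)` and `q' = q / gcd(q, Q)`. The error depends only on `q' c` modulo `m`,
which is uniform when `c` is. As the gcd is at most `q`, the bias `1/(2m)` is at most `q/(2Q)`. -/
theorem sum_exp_roundingError_le (q Q : ℕ) [NeZero q] [NeZero Q] (t : ℝ) :
    ∑ c : ZMod Q, Real.exp (t * roundingError q c) ≤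
      Q * Real.exp (t ^ 2 / 24 + |t| * (q / (2 * Q))) := by
  have hq := NeZero.pos q
  have hQ := NeZero.pos Q
  obtain ⟨q', hq'⟩ := Nat.gcd_dvd_left q Q
  obtain ⟨m, hm⟩ := Nat.gcd_dvd_right q Q
  set g := Nat.gcd q Q with hg
  have hg0 : 0 < g := Nat.gcd_pos_of_pos_left _ hq
  have hm0 : 0 < m := Nat.pos_of_mul_pos_left (hm ▸ hQ)
  have : NeZero m := ⟨hm0.ne'⟩
  have hcop : Nat.Coprime q' m := by
    have := Nat.coprime_div_gcd_div_gcd (m := q) (n := Q) hg0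
    rwa [← hg, Nat.div_eq_of_eq_mul_right hg0 hq', Nat.div_eq_of_eq_mul_right hg0 hm] at this
  have hdvd : m ∣ Q := ⟨g, by rw [mul_comm]; exact hm⟩
  set φ : ZMod Q →+ ZMod m :=
    (AddMonoidHom.mulLeft (q' : ZMod m)).comp (ZMod.castHom hdvd (ZMod m)).toAddMonoidHom with hφ
  have hφs : Function.Surjective φ := by
    intro y
    obtain ⟨x, hx⟩ := ZMod.castHom_surjective hdvd (((ZMod.unitOfCoprime q' hcop)⁻¹ : (ZMod m)ˣ) * y)
    refine ⟨x, ?_⟩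
    change (q' : ZMod m) * ZMod.castHom hdvd (ZMod m) x = y
    rw [hx, ← mul_assoc, ← ZMod.coe_unitOfCoprime q' hcop, Units.mul_inv, one_mul]
  set G : ZMod m → ℝ := fun c =>
    Real.exp (t * (((c.val : ℚ) / m - round ((c.val : ℚ) / m) : ℚ) : ℝ)) with hG
  have h1 : ∀ c : ZMod Q, Real.exp (t * roundingError q c) = G (φ c) := by
    intro c
    simp only [hG, roundingError]
    congr 3
    have hval : (φ c).val = (q' * c.val) % m := by
      have : φ c = ((q' * c.val : ℕ) : ZMod m) := by
        change (q' : ZMod m) * ZMod.castHom hdvd (ZMod m) c = _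
        rw [Nat.cast_mul]; congr 1
        rw [ZMod.castHom_apply, ZMod.natCast_val]
      rw [this, ZMod.val_natCast]
    have hx : (c.val : ℚ) * q / Q = ((φ c).val : ℚ) / m + ((q' * c.val / m : ℕ) : ℚ) := by
      have h := Nat.mod_add_div (q' * c.val) m
      rw [← hval] at h
      have h' : ((φ c).val : ℚ) + m * ((q' * c.val / m : ℕ) : ℚ) = q' * c.val := by exact_mod_cast h
      have hqq : (q : ℚ) = g * q' := by exact_mod_cast hq'
      have hQQ : (Q : ℚ) = g * m := by exact_mod_cast hm
      have hg0' : (g : ℚ) ≠ 0 := by exact_mod_cast hg0.ne'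
      have hm0' : (m : ℚ) ≠ 0 := by exact_mod_cast hm0.ne'
      rw [hqq, hQQ]; field_simp; linarith
    rw [hx, round_add_natCast, Int.cast_add, Int.cast_natCast]; ring
  have h2 := sum_comp_addMonoidHom φ hφs G
  rw [ZMod.card, ZMod.card] at h2
  have hm0' : (0 : ℝ) < m := by exact_mod_cast hm0
  have hQ0' : (0 : ℝ) < Q := by exact_mod_cast hQ
  simp only [h1]
  have h3 : (∑ c, G (φ c)) * m ≤ Q * Real.exp (t ^ 2 / 24 + |t| * (q / (2 * Q))) * m := by
    rw [h2]
    calc (Q : ℝ) * ∑ c, G c ≤ Q * (m * Real.exp (t ^ 2 / 24 + |t| / (2 * m))) :=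
          mul_le_mul_of_nonneg_left (sum_exp_fract_le m t) hQ0'.le
      _ ≤ Q * (m * Real.exp (t ^ 2 / 24 + |t| * (q / (2 * Q)))) := by
          have : |t| / (2 * m) ≤ |t| * (q / (2 * Q)) := by
            rw [div_eq_mul_one_div]
            refine mul_le_mul_of_nonneg_left ?_ (abs_nonneg t)
            rw [div_le_div_iff₀ (by positivity) (by positivity)]
            have : (Q : ℝ) ≤ q * m := by
              rw [hm]; exact_mod_cast Nat.mul_le_mul_right m (Nat.gcd_le_left _ hq)
            linarith
          gcongr
      _ = _ := by ring
  exact le_of_mul_le_mul_right h3 hm0'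

theorem sum_exp_sum_roundingError_le (K : ℝ) {n : ℕ} (q Q : ℕ) [NeZero q] [NeZero Q]
    (hK : (n * q : ℝ) ≤ K * Q) (s : Fin n → ℤ) (hs : ∀ k, s k = -1 ∨ s k = 0 ∨ s k = 1) (t : ℝ) :
    ∑ A : Fin n → ZMod Q, Real.exp (t * ∑ h, s h * roundingError q (A h)) ≤
      Fintype.card (Fin n → ZMod Q) *
        Real.exp (t ^ 2 / 24 * ∑ h, (s h : ℝ) ^ 2 + |t| * (K / 2)) := by
  have hQ0' : (0 : ℝ) < Q := by exact_mod_cast NeZero.pos Q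
  have h1 : ∑ A : Fin n → ZMod Q, Real.exp (t * ∑ h, s h * roundingError q (A h)) =
      ∏ h, ∑ a : ZMod Q, Real.exp ((t * s h) * roundingError q a) := by
    rw [Finset.prod_univ_sum, Fintype.piFinset_univ]
    refine Finset.sum_congr rfl fun A _ => ?_
    rw [← Real.exp_sum, Finset.mul_sum]
    congr 1
    exact Finset.sum_congr rfl fun h _ => by ring
  have h2 : ∀ h, ∑ a : ZMod Q, Real.exp ((t * s h) * roundingError q a) ≤
      Q * Real.exp (t ^ 2 / 24 * (s h : ℝ) ^ 2 + |t| * (q / (2 * Q))) := by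
    intro h
    refine (sum_exp_roundingError_le q Q _).trans ?_
    have e1 : |(s h : ℝ)| ≤ 1 := by rcases hs h with h | h | h <;> simp [h]
    have e2 : |t * s h| ≤ |t| := by
      rw [abs_mul]; exact mul_le_of_le_one_right (abs_nonneg t) e1
    have e3 : (t * s h) ^ 2 / 24 = t ^ 2 / 24 * (s h : ℝ) ^ 2 := by ring
    rw [e3]
    gcongr
  rw [h1]
  refine (Finset.prod_le_prod (fun h _ => Finset.sum_nonneg fun a _ => (Real.exp_pos _).le)
    fun h _ => h2 h).trans ?_
  rw [Finset.prod_mul_distrib, ← Real.exp_sum, Finset.sum_add_distrib, ← Finset.mul_sum]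
  simp only [Finset.prod_const, Finset.sum_const, Finset.card_univ, Fintype.card_fin, nsmul_eq_mul,
    Fintype.card_fun, ZMod.card, Nat.cast_pow]
  have e4 : (n : ℝ) * (|t| * (q / (2 * Q))) ≤ |t| * (K / 2) := by
    have : (n : ℝ) * (q / (2 * Q)) ≤ K / 2 := by
      rw [← mul_div_assoc, div_le_div_iff₀ (by positivity) (by norm_num)]; linarith
    calc (n : ℝ) * (|t| * (q / (2 * Q))) = |t| * (n * (q / (2 * Q))) := by ring
      _ ≤ _ := mul_le_mul_of_nonneg_left this (abs_nonneg t)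
  gcongr

variable {n N Q l lKS BKS : ℕ} [NeZero N] [NeZero Q]

/-- Averaging over the masks of the key-switching keys. -/
theorem sum_mask_exp_le (hl : 0 < lKS) (K : ℝ) (q : ℕ) [NeZero q]
    (hK : (n * q : ℝ) ≤ K * Q) (s : Fin n → ℤ) (hs : ∀ k, s k = -1 ∨ s k = 0 ∨ s k = 1) (t : ℝ)
    (F : (BKIdx n N l → ZMod Q) → ℝ) (hF : ∀ m, 0 ≤ F m)
    (d : (BKIdx n N l → ZMod Q) → Fin N → Fin lKS → Fin BKS) :
    ∑ mask : MaskIdx n N l lKS BKS → ZMod Q, F (mask ∘ Sum.inl) *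
        Real.exp (t * ∑ h, s h * roundingError q
          (-∑ i, ∑ j, mask (Sum.inr ((i, j, d (mask ∘ Sum.inl) i j), h)))) ≤
      Real.exp (t ^ 2 / 24 * ∑ h, (s h : ℝ) ^ 2 + |t| * (K / 2)) *
        ∑ mask : MaskIdx n N l lKS BKS → ZMod Q, F (mask ∘ Sum.inl) := by
  set D := Real.exp (t ^ 2 / 24 * ∑ h, (s h : ℝ) ^ 2 + |t| * (K / 2)) with hD
  set eqv := Equiv.sumArrowEquivProdArrow (BKIdx n N l) (KSIdx N lKS BKS × Fin n) (ZMod Q)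
  have key : ∀ δ : Fin N → Fin lKS → Fin BKS,
      ∑ m₂ : KSIdx N lKS BKS × Fin n → ZMod Q,
        Real.exp (t * ∑ h, s h * roundingError q (-∑ i, ∑ j, m₂ ((i, j, δ i j), h))) ≤
      Fintype.card (KSIdx N lKS BKS × Fin n → ZMod Q) * D := by
    intro δ
    set φ : (KSIdx N lKS BKS × Fin n → ZMod Q) →+ (Fin n → ZMod Q) :=
      { toFun := fun m₂ h => -∑ i, ∑ j, m₂ ((i, j, δ i j), h)
        map_zero' := by funext h; simp
        map_add' := fun x y => by
          funext h; simp [Finset.sum_add_distrib]; ring } with hφ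
    have hφs : Function.Surjective φ := by
      intro y
      -- A single selected mask already reaches every value, so one pair `(i₀, j₀)` suffices; it
      -- exists because `lKS > 0`.
      set i₀ : Fin N := ⟨0, NeZero.pos N⟩
      set j₀ : Fin lKS := ⟨0, hl⟩
      refine ⟨fun x => if x.1.1 = i₀ ∧ x.1.2.1 = j₀ then -y x.2 else 0, ?_⟩
      funext h
      change -∑ i, ∑ j, (if i = i₀ ∧ j = j₀ then -y h else 0) = y h
      simp [ite_and]
    have h1 := sum_comp_addMonoidHom φ hφs
      (fun A => Real.exp (t * ∑ h, s h * roundingError q (A h)))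
    have h2 := sum_exp_sum_roundingError_le K q Q hK s hs t
    have hc : (0 : ℝ) < Fintype.card (Fin n → ZMod Q) := by
      exact_mod_cast Fintype.card_pos
    refine le_of_mul_le_mul_right ?_ hc
    refine (le_of_eq h1).trans ?_
    calc _ ≤ (Fintype.card (KSIdx N lKS BKS × Fin n → ZMod Q) : ℝ) *
          (Fintype.card (Fin n → ZMod Q) * D) :=
          mul_le_mul_of_nonneg_left h2 (Nat.cast_nonneg _)
      _ = _ := by ring
  -- Once the bootstrapping masks are fixed, so is the selection `d`, and `key` applies to the
  -- remaining sum.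
  rw [← Equiv.sum_comp eqv.symm, ← Equiv.sum_comp eqv.symm (fun mask => F (mask ∘ Sum.inl)),
    Fintype.sum_prod_type, Fintype.sum_prod_type, Finset.mul_sum]
  refine Finset.sum_le_sum fun m₁ _ => ?_
  have e1 : ∀ m₂ : KSIdx N lKS BKS × Fin n → ZMod Q, eqv.symm (m₁, m₂) ∘ Sum.inl = m₁ :=
    fun m₂ => rfl
  have e2 : ∀ (m₂ : KSIdx N lKS BKS × Fin n → ZMod Q) x, eqv.symm (m₁, m₂) (Sum.inr x) = m₂ x :=
    fun m₂ x => rfl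
  simp only [e1, e2, ← Finset.mul_sum, Finset.sum_const, Finset.card_univ, nsmul_eq_mul]
  calc _ ≤ F m₁ * (Fintype.card (KSIdx N lKS BKS × Fin n → ZMod Q) * D) :=
        mul_le_mul_of_nonneg_left (key _) (hF _)
    _ = _ := by ring

end Rounding

-- Adapted subgaussian sums and tail bounds

section Probability

open scoped ENNReal

variable {Ω : Type*} [MeasurableSpace Ω] {μ : Measure Ω} [IsProbabilityMeasure μ]

theorem lintegral_exp_sum_le {ι : Type*} (X : ι → Ω → ℤ) (hX : iIndepFun X μ) (v : ι → ℝ≥0)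
    (hsub : ∀ i, HasSubgaussianMGF (fun ω => (X i ω : ℝ)) (v i) μ) (U : Finset ι) (a : ι → ℝ)
    (t : ℝ) :
    ∫⁻ ω, ENNReal.ofReal (Real.exp (t * ∑ i ∈ U, a i * X i ω)) ∂μ ≤
      ENNReal.ofReal (Real.exp (t ^ 2 / 2 * ∑ i ∈ U, a i ^ 2 * v i)) := by
  have h1 : iIndepFun (fun i ω => a i * (X i ω : ℝ)) μ :=
    hX.comp (fun i (x : ℤ) => a i * (x : ℝ)) fun i => measurable_of_countable _
  have h2 := HasSubgaussianMGF.sum_of_iIndepFun h1 (s := U) fun i _ => (hsub i).const_mul (a i)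
  rw [← ofReal_integral_eq_lintegral_ofReal (h2.integrable_exp_mul t)
    (Filter.Eventually.of_forall fun ω => (Real.exp_pos _).le)]
  refine ENNReal.ofReal_le_ofReal ((h2.mgf_le t).trans (Real.exp_le_exp.2 (le_of_eq ?_)))
  have e : ((∑ i ∈ U, (NNReal.mk (a i ^ 2) (sq_nonneg (a i))) * v i : ℝ≥0) : ℝ) =
      ∑ i ∈ U, a i ^ 2 * v i := by
    rw [NNReal.coe_sum]
    exact Finset.sum_congr rfl fun i _ => NNReal.coe_mul _ _
  refine (congrArg (fun x : ℝ => x * t ^ 2 / 2) e).trans ?_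
  ring

/-- Substitutes for conditioning on `X`: by independence the joint law is a product, and the inner
integral is bounded uniformly in the value of `X`. -/
theorem lintegral_mul_le_of_indepFun {α β : Type*} [MeasurableSpace α] [MeasurableSpace β]
    [Countable α] [Countable β] [MeasurableSingletonClass α] [MeasurableSingletonClass β]
    {X : Ω → α} {Y : Ω → β} (hX : Measurable X) (hY : Measurable Y) (h : IndepFun X Y μ)
    (G : α → ℝ≥0∞) (H : α → β → ℝ≥0∞) (D : ℝ≥0∞) (hH : ∀ x, ∫⁻ ω, H x (Y ω) ∂μ ≤ D) :
    ∫⁻ ω, G (X ω) * H (X ω) (Y ω) ∂μ ≤ (∫⁻ ω, G (X ω) ∂μ) * D := by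
  have hm : Measurable fun p : α × β => G p.1 * H p.1 p.2 := measurable_of_countable _
  have h1 : ∫⁻ ω, G (X ω) * H (X ω) (Y ω) ∂μ =
      ∫⁻ p, G p.1 * H p.1 p.2 ∂(μ.map fun ω => (X ω, Y ω)) :=
    (lintegral_map hm (hX.prodMk hY)).symm
  have : IsProbabilityMeasure (μ.map X) := Measure.isProbabilityMeasure_map hX.aemeasurable
  have : IsProbabilityMeasure (μ.map Y) := Measure.isProbabilityMeasure_map hY.aemeasurable
  rw [h1, (indepFun_iff_map_prod_eq_prod_map_map hX.aemeasurable hY.aemeasurable).1 h,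
    lintegral_prod _ hm.aemeasurable, ← lintegral_map (measurable_of_countable G) hX,
    ← lintegral_mul_const _ (measurable_of_countable G)]
  refine lintegral_mono fun x => ?_
  simp only
  rw [lintegral_const_mul _ (measurable_of_countable _),
    lintegral_map (measurable_of_countable _) hY]
  exact mul_le_mul_right (hH x) _

/-- The moment generating function of a sum of independent subgaussian integers whose coefficients
only depend on integers of smaller rank. -/
theorem lintegral_exp_adapted_le {ι : Type*} [Fintype ι] (X : ι → Ω → ℤ)
    (hm : ∀ i, Measurable (X i)) (hX : iIndepFun X μ) (v : ι → ℝ≥0)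
    (hsub : ∀ i, HasSubgaussianMGF (fun ω => (X i ω : ℝ)) (v i) μ) (rank : ι → ℕ)
    (c : (ι → ℤ) → ι → ℝ)
    (hc : ∀ e e' i, (∀ i', rank i' < rank i → e i' = e' i') → c e i = c e' i) (V : ℕ → ℝ)
    (hV : ∀ e T, ∑ i with rank i = T, c e i ^ 2 * v i ≤ V T) (T : ℕ) (t : ℝ) :
    ∫⁻ ω, ENNReal.ofReal (Real.exp (t * ∑ i with rank i < T,
        c (fun j => X j ω) i * X i ω)) ∂μ ≤
      ENNReal.ofReal (Real.exp (t ^ 2 / 2 * ∑ τ ∈ Finset.range T, V τ)) := by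
  classical
  induction T with
  | zero => simp
  | succ T ih =>
    set S : Finset ι := Finset.univ.filter fun i => rank i < T with hS
    set U : Finset ι := Finset.univ.filter fun i => rank i = T with hU
    have hdisj : Disjoint S U := by
      rw [Finset.disjoint_left]
      intro i hi hi'
      simp only [hS, hU, Finset.mem_filter, Finset.mem_univ, true_and] at hi hi'
      omega
    have hSU : (Finset.univ.filter fun i => rank i < T + 1) = S ∪ U := by
      ext i
      simp only [hS, hU, Finset.mem_filter, Finset.mem_univ, true_and, Finset.mem_union]
      omega
    -- The padding by `0` is harmless: coefficients of rank at most `T` see only variables of rank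
    -- less than `T`. They become functions of the `S`-block, which is independent of the `U`-block.
    set ext : (S → ℤ) → ι → ℤ := fun x i => if h : i ∈ S then x ⟨i, h⟩ else 0 with hext
    have hexts : ∀ ω i, rank i < T → ext (fun j : S => X j ω) i = X i ω := fun ω i hi => by
      have : i ∈ S := by simp [hS, hi]
      simp [hext, this]
    have hcS : ∀ ω, ∀ i, rank i ≤ T → c (ext fun j : S => X j ω) i = c (fun j => X j ω) i :=
      fun ω i hi => hc _ _ _ fun i' hi' => hexts ω i' (by omega)
    have hind := hX.indepFun_finset S U hdisj hm
    set G : (S → ℤ) → ℝ≥0∞ := fun x =>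
      ENNReal.ofReal (Real.exp (t * ∑ i ∈ S, c (ext x) i * ext x i)) with hG
    set H : (S → ℤ) → (U → ℤ) → ℝ≥0∞ := fun x y =>
      ENNReal.ofReal (Real.exp (t * ∑ i : U, c (ext x) i * y i)) with hH
    have hprod : ∀ ω, ENNReal.ofReal (Real.exp (t * ∑ i with rank i < T + 1,
        c (fun j => X j ω) i * X i ω)) =
        G (fun j : S => X j ω) * H (fun j : S => X j ω) (fun j : U => X j ω) := by
      intro ω
      rw [hG, hH, ← ENNReal.ofReal_mul (Real.exp_pos _).le, ← Real.exp_add, ← mul_add, hSU,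
        Finset.sum_union hdisj]
      congr 4
      · refine Finset.sum_congr rfl fun i hi => ?_
        have hi' : rank i < T := by simpa [hS] using hi
        rw [hcS ω i hi'.le, hexts ω i hi']
      · rw [← Finset.sum_coe_sort U]
        refine Finset.sum_congr rfl fun i _ => ?_
        have hi' : rank i = T := (Finset.mem_filter.1 i.2).2
        rw [hcS ω i hi'.le]
    have hGX : ∀ ω, G (fun j : S => X j ω) = ENNReal.ofReal (Real.exp (t * ∑ i with rank i < T,
        c (fun j => X j ω) i * X i ω)) := by
      intro ω
      have hsum : ∑ i ∈ S, c (ext fun j : S => X j ω) i * ext (fun j : S => X j ω) i =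
          ∑ i ∈ S, c (fun j => X j ω) i * X i ω := by
        refine Finset.sum_congr rfl fun i hi => ?_
        have hi' : rank i < T := (Finset.mem_filter.1 hi).2
        rw [hcS ω i hi'.le, hexts ω i hi']
      simp only [hG]
      rw [hsum]
    simp only [hprod]
    refine (lintegral_mul_le_of_indepFun (measurable_pi_lambda _ fun j : S => hm j)
      (measurable_pi_lambda _ fun j : U => hm j) hind G H
      (ENNReal.ofReal (Real.exp (t ^ 2 / 2 * V T))) fun x => ?_).trans ?_
    · have h1 := lintegral_exp_sum_le X hX v hsub U (c (ext x)) t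
      have h2 : ∀ ω, H x (fun j : U => X j ω) =
          ENNReal.ofReal (Real.exp (t * ∑ i ∈ U, c (ext x) i * X i ω)) := fun ω => by
        rw [hH, ← Finset.sum_coe_sort U]
      simp only [h2]
      refine h1.trans (ENNReal.ofReal_le_ofReal (Real.exp_le_exp.2 ?_))
      exact mul_le_mul_of_nonneg_left (hV _ T) (by positivity)
    · simp only [hGX]
      rw [Finset.sum_range_succ, mul_add, Real.exp_add, ENNReal.ofReal_mul (Real.exp_pos _).le]
      exact mul_le_mul_left ih _

theorem lintegral_uniformOn_univ {α : Type*} [Fintype α] [MeasurableSpace α]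
    [MeasurableSingletonClass α] (f : α → ℝ≥0∞) :
    ∫⁻ x, f x ∂(uniformOn (Set.univ : Set α)) = (Fintype.card α : ℝ≥0∞)⁻¹ * ∑ x, f x := by
  rw [uniformOn, ProbabilityTheory.cond, lintegral_smul_measure, Measure.restrict_univ, lintegral_count,
    tsum_fintype, Measure.count_univ]
  simp

/-- Chernoff's bound at `a = ±u/V`; the two tails cost the factor `2`. -/
theorem isSubgaussian_of_lintegral_exp_le {X : Ω → ℝ} (hX : Measurable X) {C V : ℝ} (hC : 0 ≤ C)
    (hV : 0 < V) (h : ∀ a : ℝ, ∫⁻ ω, ENNReal.ofReal (Real.exp (a * X ω)) ∂μ ≤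
      ENNReal.ofReal (C * Real.exp (V * a ^ 2 / 2))) :
    IsSubgaussian μ (2 * C) V X := by
  have hint : ∀ a : ℝ, Integrable (fun ω => Real.exp (a * X ω)) μ := fun a => by
    refine ⟨by fun_prop, ?_⟩
    rw [hasFiniteIntegral_iff_ofReal (Filter.Eventually.of_forall fun ω => (Real.exp_pos _).le)]
    exact (h a).trans_lt ENNReal.ofReal_lt_top
  have hmgf : ∀ a : ℝ, mgf X μ a ≤ C * Real.exp (V * a ^ 2 / 2) := fun a => by
    have h1 := h a
    rw [← ofReal_integral_eq_lintegral_ofReal (hint a)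
      (Filter.Eventually.of_forall fun ω => (Real.exp_pos _).le)] at h1
    exact (ENNReal.ofReal_le_ofReal_iff (by positivity)).1 h1
  refine ⟨hint, fun a => (hmgf a).trans ?_, fun u hu => ?_⟩
  · nlinarith [mul_nonneg hC (Real.exp_pos (V * a ^ 2 / 2)).le]
  · have hgen : ∀ a : ℝ, a ^ 2 = (u / V) ^ 2 →
        Real.exp (-(u / V) * u) * mgf X μ a ≤ C * Real.exp (-u ^ 2 / (2 * V)) := fun a ha => by
      refine (mul_le_mul_of_nonneg_left (hmgf a) (Real.exp_pos _).le).trans (le_of_eq ?_)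
      rw [ha, mul_left_comm, ← Real.exp_add]
      congr 2; field_simp; ring
    have hpos := measure_ge_le_exp_mul_mgf (μ := μ) (X := X) u (t := u / V) (by positivity)
      (hint _)
    have hneg := measure_le_le_exp_mul_mgf (μ := μ) (X := X) (-u) (t := -(u / V))
      (by simp only [Left.neg_nonpos_iff]; positivity) (hint _)
    have hsub : {ω | u < |X ω|} ⊆ {ω | u ≤ X ω} ∪ {ω | X ω ≤ -u} := by
      intro ω hω
      rcases lt_abs.1 (show u < |X ω| from hω) with h | h
      · exact Or.inl h.le
      · exact Or.inr (by simp only [Set.mem_ofPred_eq]; linarith)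
    have h1 := hgen (u / V) rfl
    have h2 := hgen (-(u / V)) (by ring)
    have e : -(-(u / V)) * -u = -(u / V) * u := by ring
    rw [e] at hneg
    calc μ.real {ω | u < |X ω|} ≤ μ.real ({ω | u ≤ X ω} ∪ {ω | X ω ≤ -u}) :=
          measureReal_mono hsub
      _ ≤ μ.real {ω | u ≤ X ω} + μ.real {ω | X ω ≤ -u} := measureReal_union_le _ _
      _ ≤ _ := by linarith

/-- The square `(|a| - 12L)² ≥ 0` trades a bounded shift `L` for an extra variance `1/12` and a
constant factor. -/
theorem exp_shift_le (L a V : ℝ) :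
    Real.exp (|a| * L) * (2 * Real.exp (V * a ^ 2 / 2)) ≤
      2 * Real.exp (6 * L ^ 2) * Real.exp ((V + 1 / 12) * a ^ 2 / 2) := by
  have h : |a| * L + V * a ^ 2 / 2 ≤ 6 * L ^ 2 + (V + 1 / 12) * a ^ 2 / 2 := by
    nlinarith [sq_nonneg (|a| - 12 * L), sq_abs a]
  calc Real.exp (|a| * L) * (2 * Real.exp (V * a ^ 2 / 2)) =
        2 * Real.exp (|a| * L + V * a ^ 2 / 2) := by rw [Real.exp_add]; ring
    _ ≤ 2 * Real.exp (6 * L ^ 2 + (V + 1 / 12) * a ^ 2 / 2) := by gcongr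
    _ = _ := by rw [Real.exp_add]; ring

/-- Only absolute values are compared, because reduction to the representative may change the sign;
hence both exponentials are needed. -/
theorem exp_mul_le_of_abs_le {x y b : ℝ} (a : ℝ) (h : |x| ≤ |y| + b) :
    Real.exp (a * x) ≤ Real.exp (|a| * b) * (Real.exp (a * y) + Real.exp (-a * y)) := by
  have h1 : a * x ≤ |a| * b + |a * y| := by
    calc a * x ≤ |a| * |x| := by rw [← abs_mul]; exact le_abs_self _
      _ ≤ |a| * (|y| + b) := mul_le_mul_of_nonneg_left h (abs_nonneg a)
      _ = _ := by rw [abs_mul]; ring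
  refine (Real.exp_le_exp.2 h1).trans ?_
  rw [Real.exp_add]
  refine mul_le_mul_of_nonneg_left ?_ (Real.exp_pos _).le
  rcases abs_cases (a * y) with ⟨h, _⟩ | ⟨h, _⟩ <;> rw [h]
  · linarith [Real.exp_pos (-a * y)]
  · rw [neg_mul]; linarith [Real.exp_pos (a * y)]

end Probability

-- Moment generating function of the output error

section Final

open scoped ENNReal

variable {Ω : Type*} [MeasurableSpace Ω] {μ : Measure Ω} [IsProbabilityMeasure μ]
  {n N Q l lKS BKS : ℕ} [NeZero N] [NeZero Q]

/-- The round in which an error is used; the key-switching errors come last. -/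
def errRank : ErrIdx n N l lKS BKS → ℕ
  | Sum.inl i => i.1
  | Sum.inr _ => n

/-- The coefficients of the errors in the phase of the key-switched ciphertext. -/
def errCoeff (ρ : ℝ) (c : (BKIdx n N l → ℤ) → BKIdx n N l → ℤ)
    (d : (BKIdx n N l → ℤ) → Fin N → Fin lKS → Fin BKS) (e : ErrIdx n N l lKS BKS → ℤ) :
    ErrIdx n N l lKS BKS → ℝ
  | Sum.inl i => ρ * c (e ∘ Sum.inl) i
  | Sum.inr (i, j, k) => if k = d (e ∘ Sum.inl) i j then -ρ else 0

theorem sum_errCoeff_mul (ρ : ℝ) (c : (BKIdx n N l → ℤ) → BKIdx n N l → ℤ)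
    (d : (BKIdx n N l → ℤ) → Fin N → Fin lKS → Fin BKS) (e : ErrIdx n N l lKS BKS → ℤ) :
    ∑ i, errCoeff ρ c d e i * e i =
      ρ * (∑ i, c (e ∘ Sum.inl) i * e (Sum.inl i)
        - ∑ i, ∑ j, e (Sum.inr (i, j, d (e ∘ Sum.inl) i j)) : ℤ) := by
  have h1 : ∑ i, errCoeff ρ c d e (Sum.inl i) * e (Sum.inl i) =
      ρ * ∑ i, (c (e ∘ Sum.inl) i : ℝ) * e (Sum.inl i) := by
    rw [Finset.mul_sum]
    exact Finset.sum_congr rfl fun i _ => by rw [errCoeff]; ring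
  have h2 : ∑ i, errCoeff ρ c d e (Sum.inr i) * e (Sum.inr i) =
      -(ρ * ∑ i, ∑ j, (e (Sum.inr (i, j, d (e ∘ Sum.inl) i j)) : ℝ)) := by
    rw [Fintype.sum_prod_type, Finset.mul_sum, ← Finset.sum_neg_distrib]
    refine Finset.sum_congr rfl fun i _ => ?_
    rw [Fintype.sum_prod_type, Finset.mul_sum, ← Finset.sum_neg_distrib]
    refine Finset.sum_congr rfl fun j _ => ?_
    simp [errCoeff]
  rw [Fintype.sum_sum_type, h1, h2]
  push_cast
  ring

/-- A bootstrapping round uses `2 · 2 · l · N` errors (sign, block, digit, coefficient), each with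
coefficient at most `|ρ| B` in absolute value. In the key switch exactly one key is selected for
each of the `N · lKS` pairs. -/
theorem sum_errCoeff_sq_le (ρ : ℝ) (B : ℕ) (c : (BKIdx n N l → ℤ) → BKIdx n N l → ℤ)
    (d : (BKIdx n N l → ℤ) → Fin N → Fin lKS → Fin BKS) (hc : ∀ e i, |c e i| ≤ B) (σ σKS : ℝ≥0)
    (e : ErrIdx n N l lKS BKS → ℤ) (T : ℕ) :
    ∑ i with errRank i = T, errCoeff ρ c d e i ^ 2 *
        (Sum.elim (fun _ => σ ^ 2) (fun _ => σKS ^ 2) i : ℝ≥0) ≤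
      if T < n then 4 * N * l * B ^ 2 * ρ ^ 2 * σ ^ 2 else N * lKS * ρ ^ 2 * σKS ^ 2 := by
  rw [Finset.sum_filter, Fintype.sum_sum_type]
  by_cases hT : T < n
  · rw [if_pos hT]
    have h1 : ∀ i : BKIdx n N l, (if errRank (Sum.inl i : ErrIdx n N l lKS BKS) = T then
        errCoeff ρ c d e (Sum.inl i) ^ 2 * (σ ^ 2 : ℝ≥0) else 0) ≤
        if i.1 = ⟨T, hT⟩ then (B : ℝ) ^ 2 * ρ ^ 2 * σ ^ 2 else 0 := fun i => by
      by_cases h : (i.1 : ℕ) = T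
      · rw [if_pos (show errRank (Sum.inl i : ErrIdx n N l lKS BKS) = T from h),
          if_pos (Fin.ext h), errCoeff, mul_pow, mul_comm (ρ ^ 2), NNReal.coe_pow]
        have h2 : (c (e ∘ Sum.inl) i : ℝ) ^ 2 ≤ (B : ℝ) ^ 2 := by
          rw [← sq_abs]
          have : |(c (e ∘ Sum.inl) i : ℝ)| ≤ B := by exact_mod_cast hc (e ∘ Sum.inl) i
          gcongr
        gcongr
      · rw [if_neg (show ¬ errRank (Sum.inl i : ErrIdx n N l lKS BKS) = T from h),
          if_neg fun h' => h (congrArg Fin.val h')]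
    have h2 : ∀ i : KSIdx N lKS BKS, ¬ errRank (Sum.inr i : ErrIdx n N l lKS BKS) = T :=
      fun i => hT.ne'
    refine (add_le_add (Finset.sum_le_sum fun i _ => h1 i)
      (Finset.sum_nonpos fun i _ => (if_neg (h2 i)).le)).trans (le_of_eq ?_)
    rw [Fintype.sum_prod_type, Finset.sum_comm]
    simp
    ring
  · rw [if_neg hT]
    have h1 : ∀ i : BKIdx n N l, ¬ errRank (Sum.inl i : ErrIdx n N l lKS BKS) = T := fun i h =>
      hT (h ▸ i.1.2)
    have h2 : ∀ i : KSIdx N lKS BKS, (if errRank (Sum.inr i : ErrIdx n N l lKS BKS) = T then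
        errCoeff ρ c d e (Sum.inr i) ^ 2 * (σKS ^ 2 : ℝ≥0) else 0) ≤
        if i.2.2 = d (e ∘ Sum.inl) i.1 i.2.1 then ρ ^ 2 * (σKS : ℝ) ^ 2 else 0 := by
      rintro ⟨i, j, k⟩
      simp only [errCoeff, NNReal.coe_pow]
      split_ifs
      · rw [neg_sq]
      · simp
      · positivity
      · exact le_rfl
    refine (add_le_add (Finset.sum_nonpos fun i _ => (if_neg (h1 i)).le)
      (Finset.sum_le_sum fun i _ => h2 i)).trans (le_of_eq ?_)
    simp only [Fintype.sum_prod_type, Finset.sum_ite_eq', Finset.mem_univ, if_true,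
      Finset.sum_const, Finset.card_univ, Fintype.card_fin, nsmul_eq_mul]
    ring

/-- The order of averaging matters. With the errors fixed, the masks are averaged, which bounds the
rounding factor by `D` because `E` involves only bootstrapping masks. Then sum and integral are
exchanged, and for fixed masks the errors are integrated. -/
theorem lintegral_exp_boot_le (hl : 0 < lKS) (K : ℝ) (q : ℕ) [NeZero q]
    (hK : (n * q : ℝ) ≤ K * Q) (s : Fin n → ℤ) (hs : ∀ k, s k = -1 ∨ s k = 0 ∨ s k = 1) (B : ℕ)
    (σ σKS : ℝ≥0) (mask : Ω → MaskIdx n N l lKS BKS → ZMod Q) (err : Ω → ErrIdx n N l lKS BKS → ℤ)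
    (hrand : IsKeyRandomness μ σ σKS mask err)
    (c : (BKIdx n N l → ZMod Q) → (BKIdx n N l → ℤ) → BKIdx n N l → ℤ)
    (d : (BKIdx n N l → ZMod Q) → (BKIdx n N l → ℤ) → Fin N → Fin lKS → Fin BKS)
    (hc1 : ∀ m e i, |c m e i| ≤ B)
    (hc2 : ∀ m e e' i, (∀ i', i'.1 < i.1 → e i' = e' i') → c m e i = c m e' i) (t : ℝ) :
    ∫⁻ ω, ENNReal.ofReal (Real.exp (t * linearError q s c d (mask ω) (err ω))) ∂μ ≤
      ENNReal.ofReal (Real.exp (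
        (4 * n * N * l * B ^ 2 * ((q : ℝ) / Q) ^ 2 * σ ^ 2
          + N * lKS * ((q : ℝ) / Q) ^ 2 * σKS ^ 2 + (∑ k, (s k : ℝ) ^ 2) / 12) * t ^ 2 / 2
        + |t| * (K / 2))) := by
  set ρ : ℝ := (q : ℝ) / Q with hρ
  set E : (BKIdx n N l → ZMod Q) → (ErrIdx n N l lKS BKS → ℤ) → ℝ := fun m e =>
    ∑ i, errCoeff ρ (c m) (d m) e i * e i with hE
  set R : (MaskIdx n N l lKS BKS → ZMod Q) → (ErrIdx n N l lKS BKS → ℤ) → ℝ := fun m e =>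
    ∑ h, s h * roundingError q (-∑ i, ∑ j,
      m (Sum.inr ((i, j, d (m ∘ Sum.inl) (e ∘ Sum.inl) i j), h))) with hR
  set D : ℝ := Real.exp (t ^ 2 / 24 * ∑ h, (s h : ℝ) ^ 2 + |t| * (K / 2)) with hD
  set W : ℝ := 4 * n * N * l * B ^ 2 * ρ ^ 2 * σ ^ 2 + N * lKS * ρ ^ 2 * σKS ^ 2 with hW
  have hEbound : ∀ m, ∫⁻ ω, ENNReal.ofReal (Real.exp (t * E m (err ω))) ∂μ ≤
      ENNReal.ofReal (Real.exp (t ^ 2 / 2 * W)) := by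
    intro m
    have h := lintegral_exp_adapted_le (fun i ω => err ω i)
      (fun i => (measurable_pi_apply i).comp hrand.measurable_err) hrand.indep_err
      (Sum.elim (fun _ => σ ^ 2) (fun _ => σKS ^ 2))
      (by
        rintro (i | i)
        · exact hrand.subgaussian_boot i
        · exact hrand.subgaussian_switch i)
      errRank (errCoeff ρ (c m) (d m))
      (by
        rintro e e' (i | ⟨i, j, k⟩) h
        · simp only [errCoeff]
          rw [hc2 m (e ∘ Sum.inl) (e' ∘ Sum.inl) i fun i' hi' => h (Sum.inl i') hi']
        · have : e ∘ Sum.inl = e' ∘ Sum.inl := by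
            funext i'
            exact h (Sum.inl i') i'.1.2
          simp only [errCoeff, this])
      (fun T => if T < n then 4 * N * l * B ^ 2 * ρ ^ 2 * σ ^ 2 else N * lKS * ρ ^ 2 * σKS ^ 2)
      (sum_errCoeff_sq_le ρ B (c m) (d m) (hc1 m) σ σKS) (n + 1) t
    have hall : (Finset.univ.filter fun i : ErrIdx n N l lKS BKS => errRank i < n + 1) =
        Finset.univ := by
      refine Finset.filter_true_of_mem fun i _ => ?_
      rcases i with i | i
      · exact i.1.2.trans n.lt_succ_self
      · exact n.lt_succ_self
    have hsum : ∑ T ∈ Finset.range (n + 1), (if T < n then 4 * N * l * B ^ 2 * ρ ^ 2 * (σ : ℝ) ^ 2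
        else N * lKS * ρ ^ 2 * (σKS : ℝ) ^ 2) = W := by
      rw [Finset.sum_range_succ, if_neg (lt_irrefl n),
        Finset.sum_congr rfl fun T hT => if_pos (Finset.mem_range.1 hT)]
      simp [hW]; ring
    rw [hall, hsum] at h
    exact h
  have hmask : IsProbabilityMeasure (μ.map mask) :=
    Measure.isProbabilityMeasure_map hrand.measurable_mask.aemeasurable
  have herr : IsProbabilityMeasure (μ.map err) :=
    Measure.isProbabilityMeasure_map hrand.measurable_err.aemeasurable
  set κ : ℝ≥0∞ := (Fintype.card (MaskIdx n N l lKS BKS → ZMod Q) : ℝ≥0∞)⁻¹ with hκ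
  have hinner : ∀ e, ∑ m : MaskIdx n N l lKS BKS → ZMod Q,
      ENNReal.ofReal (Real.exp (t * (E (m ∘ Sum.inl) e + R m e))) ≤
      ENNReal.ofReal D * ∑ m : MaskIdx n N l lKS BKS → ZMod Q,
        ENNReal.ofReal (Real.exp (t * E (m ∘ Sum.inl) e)) := by
    intro e
    rw [← ENNReal.ofReal_sum_of_nonneg fun m _ => (Real.exp_pos _).le,
      ← ENNReal.ofReal_sum_of_nonneg fun m _ => (Real.exp_pos _).le,
      ← ENNReal.ofReal_mul (Real.exp_pos _).le]
    refine ENNReal.ofReal_le_ofReal ?_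
    have h := sum_mask_exp_le hl K q hK s hs t (fun m => Real.exp (t * E m e))
      (fun m => (Real.exp_pos _).le) (fun m => d m (e ∘ Sum.inl))
    have hadd : ∀ m : MaskIdx n N l lKS BKS → ZMod Q,
        Real.exp (t * (E (m ∘ Sum.inl) e + R m e)) =
          Real.exp (t * E (m ∘ Sum.inl) e) * Real.exp (t * R m e) := fun m => by
      rw [mul_add, Real.exp_add]
    simp only [hadd]
    exact h
  have hmeas : Measurable fun p : (MaskIdx n N l lKS BKS → ZMod Q) × (ErrIdx n N l lKS BKS → ℤ) =>
      ENNReal.ofReal (Real.exp (t * (E (p.1 ∘ Sum.inl) p.2 + R p.1 p.2))) :=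
    measurable_of_countable _
  have hZ : ∀ ω, linearError q s c d (mask ω) (err ω) =
      E (mask ω ∘ Sum.inl) (err ω) + R (mask ω) (err ω) := fun ω => by
    rw [hE, hR, linearError]
    exact congrArg (· + _) (sum_errCoeff_mul ρ _ _ (err ω)).symm
  simp only [hZ]
  calc ∫⁻ ω, ENNReal.ofReal (Real.exp (t * (E (mask ω ∘ Sum.inl) (err ω) + R (mask ω) (err ω)))) ∂μ
      = ∫⁻ p, ENNReal.ofReal (Real.exp (t * (E (p.1 ∘ Sum.inl) p.2 + R p.1 p.2)))
          ∂(μ.map fun ω => (mask ω, err ω)) :=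
        (lintegral_map hmeas (hrand.measurable_mask.prodMk hrand.measurable_err)).symm
    _ = ∫⁻ e, κ * ∑ m : MaskIdx n N l lKS BKS → ZMod Q,
          ENNReal.ofReal (Real.exp (t * (E (m ∘ Sum.inl) e + R m e))) ∂(μ.map err) := by
        rw [(indepFun_iff_map_prod_eq_prod_map_map hrand.measurable_mask.aemeasurable
          hrand.measurable_err.aemeasurable).1 hrand.indep_mask_err,
          lintegral_prod_symm _ hmeas.aemeasurable]
        refine lintegral_congr fun e => ?_
        rw [hrand.uniform_mask, lintegral_uniformOn_univ]
    _ ≤ ∫⁻ e, κ * (ENNReal.ofReal D * ∑ m : MaskIdx n N l lKS BKS → ZMod Q,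
          ENNReal.ofReal (Real.exp (t * E (m ∘ Sum.inl) e))) ∂(μ.map err) :=
        lintegral_mono fun e => mul_le_mul_right (hinner e) _
    _ = κ * (ENNReal.ofReal D * ∑ m : MaskIdx n N l lKS BKS → ZMod Q,
          ∫⁻ ω, ENNReal.ofReal (Real.exp (t * E (m ∘ Sum.inl) (err ω))) ∂μ) := by
        rw [lintegral_const_mul _ (measurable_of_countable _),
          lintegral_const_mul _ (measurable_of_countable _),
          lintegral_finsetSum _ fun m _ => measurable_of_countable _]
        congr 3
        funext m
        exact lintegral_map (measurable_of_countable _) hrand.measurable_err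
    _ ≤ κ * (ENNReal.ofReal D * ∑ _m : MaskIdx n N l lKS BKS → ZMod Q,
          ENNReal.ofReal (Real.exp (t ^ 2 / 2 * W))) :=
        mul_le_mul_right (mul_le_mul_right (Finset.sum_le_sum fun m _ => hEbound _) _) _
    _ = ENNReal.ofReal D * ENNReal.ofReal (Real.exp (t ^ 2 / 2 * W)) := by
        rw [Finset.sum_const, Finset.card_univ, nsmul_eq_mul, mul_left_comm, ← mul_assoc κ, hκ,
          ENNReal.inv_mul_cancel, one_mul]
        · exact_mod_cast Fintype.card_ne_zero
        · exact ENNReal.natCast_ne_top _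
    _ = _ := by
        rw [hD, ← ENNReal.ofReal_mul (Real.exp_pos _).le, ← Real.exp_add]
        congr 2
        ring

/-- The inner factor `2` comes from the two signs of `Z`, the outer one from the two tails; the bias
`k` and the offset `b` are absorbed together. -/
theorem isSubgaussian_of_abs_le {X Z : Ω → ℝ} (hX : Measurable X) (hZ : Measurable Z) {b k V : ℝ}
    (hV : 0 ≤ V) (h : ∀ ω, |X ω| ≤ |Z ω| + b)
    (hmgf : ∀ a : ℝ, ∫⁻ ω, ENNReal.ofReal (Real.exp (a * Z ω)) ∂μ ≤
      ENNReal.ofReal (Real.exp (V * a ^ 2 / 2 + |a| * k))) :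
    IsSubgaussian μ (2 * (2 * Real.exp (6 * (k + b) ^ 2))) (V + 1 / 12) X := by
  refine isSubgaussian_of_lintegral_exp_le hX (by positivity) (by positivity) fun a => ?_
  have hmeas : ∀ a : ℝ, Measurable fun ω => ENNReal.ofReal (Real.exp (a * Z ω)) := fun a => by
    fun_prop
  have hneg := hmgf (-a)
  rw [neg_sq, abs_neg] at hneg
  calc _ ≤ ∫⁻ ω, ENNReal.ofReal (Real.exp (|a| * b)) *
        (ENNReal.ofReal (Real.exp (a * Z ω)) + ENNReal.ofReal (Real.exp (-a * Z ω))) ∂μ := by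
        refine lintegral_mono fun ω => ?_
        rw [← ENNReal.ofReal_add (Real.exp_pos _).le (Real.exp_pos _).le,
          ← ENNReal.ofReal_mul (Real.exp_pos _).le]
        exact ENNReal.ofReal_le_ofReal (exp_mul_le_of_abs_le a (h ω))
    _ = ENNReal.ofReal (Real.exp (|a| * b)) *
        (∫⁻ ω, ENNReal.ofReal (Real.exp (a * Z ω)) ∂μ +
          ∫⁻ ω, ENNReal.ofReal (Real.exp (-a * Z ω)) ∂μ) := by
        rw [lintegral_const_mul _ (by fun_prop), lintegral_add_left (hmeas a)]
    _ ≤ ENNReal.ofReal (Real.exp (|a| * b)) *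
        (ENNReal.ofReal (Real.exp (V * a ^ 2 / 2 + |a| * k)) +
          ENNReal.ofReal (Real.exp (V * a ^ 2 / 2 + |a| * k))) :=
        mul_le_mul_right (add_le_add (hmgf a) hneg) _
    _ ≤ _ := by
        rw [← ENNReal.ofReal_add (Real.exp_pos _).le (Real.exp_pos _).le,
          ← ENNReal.ofReal_mul (Real.exp_pos _).le]
        refine ENNReal.ofReal_le_ofReal ((le_of_eq ?_).trans (exp_shift_le (k + b) a V))
        rw [mul_add |a|, Real.exp_add, Real.exp_add]; ring

theorem IsKeyRandomness.measurable_comp {σ σKS : ℝ≥0}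
    {mask : Ω → MaskIdx n N l lKS BKS → ZMod Q} {err : Ω → ErrIdx n N l lKS BKS → ℤ}
    (h : IsKeyRandomness μ σ σKS mask err)
    (g : (MaskIdx n N l lKS BKS → ZMod Q) → (ErrIdx n N l lKS BKS → ℤ) → ℝ) :
    Measurable fun ω => g (mask ω) (err ω) :=
  (measurable_of_countable fun p : (MaskIdx n N l lKS BKS → ZMod Q) ×
    (ErrIdx n N l lKS BKS → ℤ) => g p.1 p.2).comp (h.measurable_mask.prodMk h.measurable_err)

end Final

end BootMMPM

theorem mainTheorem2 (K : ℝ) :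
    ∃ C : ℝ, 0 < C ∧
      ∀ (n N r q Q t t' B BKS : ℕ) [NeZero N] [NeZero r] [NeZero q] [NeZero Q] [NeZero t]
        [NeZero t'] [NeZero BKS],
        Even t → 1 < B → 1 < BKS → q < Q →
        (n * q : ℝ) ≤ K * Q → ((Q % t' : ℕ) * q : ℝ) ≤ K * Q → ((q % t' : ℕ) : ℝ) ≤ K →
        ∀ (f : ZMod t → ZMod t') (f' : ZMod (2 * N * r) → ZMod t'),
        BootMMPM.IsNegacyclic f → BootMMPM.IsNegacyclicExtension f f' →
        ∀ (s : Fin n → ℤ), (∀ k, s k = -1 ∨ s k = 0 ∨ s k = 1) →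
        ∀ (z : BootMMPM.Rq N Q) (ct : BootMMPM.LWE n q) (m : ZMod t),
        BootMMPM.LWE.DecryptsTo (fun k => (s k : ZMod (2 * N * r))) m
          (BootMMPM.modSwitch (2 * N * r) ct) →
        ∀ (Ω : Type*) [MeasurableSpace Ω] (μ : Measure Ω) [IsProbabilityMeasure μ]
          (σ σKS : ℝ≥0)
          (mask : Ω → BootMMPM.MaskIdx n N (BootMMPM.digits B Q) (BootMMPM.digits BKS Q) BKS →
            ZMod Q)
          (err : Ω → BootMMPM.ErrIdx n N (BootMMPM.digits B Q) (BootMMPM.digits BKS Q) BKS → ℤ),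
        BootMMPM.IsKeyRandomness μ σ σKS mask err →
        BootMMPM.IsSubgaussian μ C
          (4 * n * N * BootMMPM.digits B Q * B ^ 2 * ((q : ℝ) / Q) ^ 2 * σ ^ 2
            + N * BootMMPM.digits BKS Q * ((q : ℝ) / Q) ^ 2 * σKS ^ 2
            + ((∑ k, (s k : ℝ) ^ 2) + 1) / 12)
          (fun ω => ((BootMMPM.LWE.error (fun k => (s k : ZMod q)) (f m)
            (BootMMPM.boot B (BootMMPM.bootKeys B s z (mask ω) (err ω))
              (BootMMPM.switchKeys s z (mask ω) (err ω)) f' ct) : ℤ) : ℝ)) := by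
  -- Here `K / 2` is the total bias of the mask roundings, and `2 * K + 1 / 2` comes from the floors
  -- and the rounding of the body.
  refine ⟨2 * (2 * Real.exp (6 * (K / 2 + (2 * K + 1 / 2)) ^ 2)), by positivity, ?_⟩
  intro n N r q Q t t' B BKS _ _ _ _ _ _ _ _ hB hBKS hqQ h1 h2 h3 f f' _ hf' s hs z ct m hct
    Ω _ μ _ σ σKS mask err hrand
  -- This makes the number of key-switching digits positive, as the uniformity of the output mask
  -- requires.
  have hQ : 1 < Q := lt_of_le_of_lt (NeZero.pos q) hqQ
  obtain ⟨c, d, hc1, hc2, herr⟩ := BootMMPM.exists_boot_error (l := BootMMPM.digits B Q)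
    (lKS := BootMMPM.digits BKS Q) (BKS := BKS) K B (by omega) (Nat.le_pow_clog hB Q)
    (Nat.le_pow_clog hBKS Q) h2 h3 f f' hf' s hs z ct m hct
  have key := BootMMPM.isSubgaussian_of_abs_le
    (hrand.measurable_comp fun mk er => ((BootMMPM.LWE.error (fun k => (s k : ZMod q)) (f m)
      (BootMMPM.boot B (BootMMPM.bootKeys B s z mk er)
        (BootMMPM.switchKeys s z mk er) f' ct) : ℤ) : ℝ))
    (hrand.measurable_comp (BootMMPM.linearError q s c d)) (by positivity)
    (fun ω => herr (mask ω) (err ω))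
    (BootMMPM.lintegral_exp_boot_le (Nat.clog_pos hBKS hQ) K q h1 s hs B σ σKS mask err
      hrand c d hc1 hc2)
  convert key using 1
  ring
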